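/- Let $P\in\mathbb C^{n\times n}$ with $P^2=I$. A matrix $H\in\mathbb C^{n\times n}$ is PT-symmetric if $P\overline H=HP$. It is pseudo-Hermitian with metric $G$ if $G$ is Hermitian and non-singular and $H=-G^{-1}S$ for a Hermitian $S$. The action of $\psi\in\mathbb C^n$ is $\psi^*G\psi$. A real eigenvalue $\lambda$ of such an $H$ is of the first (second) kind if all its eigenvectors have positive (negative) action, definite if it is of the first or of the second kind, and of mixed kind (a Krein collision) if it has an eigenvector of zero action. $H$ is unbroken if all its eigenvalues are real. $H$ is strongly stable in a set $W$ of matrices if all matrices of $W$ in a neighbourhood of $H$ are unbroken. A breaking curve in $W$ for $H$ at $\lambda\in\mathbb R$ is a continuous curve $\gamma:\mathbb R\to W$ with $\gamma(0)=H$ such that: for some $\varepsilon>0$ all eigenvalues of $\gamma(t)$, $t\le 0$, at distance less than $\varepsilon$ from $\lambda$ are real; if $H$ is unbroken, so is $\gamma(t)$ for all $t\le0$; and each $\gamma(t)$, $t>0$, has a non-real eigenvalue $\mu(t)$ with $\mu(t)\to\lambda$ as $t\to0^+$. (1) Every PT-symmetric $H$ is pseudo-Hermitian with some metric. (2) If $H$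 is pseudo-Hermitian with metric $G$, then a real number $\lambda$ is an eigenvalue of mixed kind if and only if its generalized eigenspace contains both a vector of positive action and a vector of negative action; in that case $\lambda$ has algebraic multiplicity at least $2$. (3) Let $X$ be a topological space, let $H(x)$ ($x\in X$) be PT-symmetric and pseudo-Hermitian with metric $G(x)$, and let $H$ and $G$ be continuous at $x_0$. If $H(x_0)$ is unbroken but $H(x)$ is not unbroken for parameters $x$ arbitrarily close to $x_0$, then $H(x_0)$ has an eigenvalue $\lambda\in\mathbb R$ of mixed kind such that non-real eigenvalues arbitrarily close to $\lambda$ occur at parameters arbitrarily close to $x_0$; and every real $\lambda$ at which non-real eigenvalues accumulate in this way is an eigenvalue of $H(x_0)$ of mixed kind. Collisions of modes with the same sign of action do not break the symmetry: if $\lambda$ is a definite eigenvalue of $H(x_0)$, there is $\varepsilon>0$ such that for all $x$ near $x_0$ every eigenvalue of $H(x)$ at distance less than $\varepsilon$ from $\lambda$ is real; and if $H(x_0)$ is unbroken and all its eigenvalues are definite, then $H(x)$ is unbroken for all $x$ near $x_0$. (4) Let $H$ be pseudo-Hermitian with metric $G$, and let $W$ be the set of all matrices that are pseudo-Hermitian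 with metric $G$. Then $H$ is strongly stable in $W$ if and only if all its eigenvalues are real and definite; and a real number $\lambda$ is an eigenvalue of $H$ of mixed kind if and only if there is a breaking curve in $W$ for $H$ at $\lambda$. (5) Suppose that $P$ is real, that is, parity commutes with complex conjugation. Then every PT-symmetric $H$ is pseudo-Hermitian with a metric $G$ that satisfies $P^*GP=\overline G$. If $H$ is PT-symmetric and pseudo-Hermitian with such a metric $G$, then the two equivalences of (4) hold with $W$ replaced by the set of all matrices that are both PT-symmetric (with the same $P$) and pseudo-Hermitian with metric $G$. -/

import Mathlib

open Filter Topology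

namespace PTKrein

/-- The entrywise complex conjugate of a matrix. -/
noncomputable def conjMatrix {n : Type*} (M : Matrix n n ℂ) : Matrix n n ℂ :=
  M.map (starRingEnd ℂ)

/-- A parity operator: a linear operator `P` with `P² = I`. -/
def IsParity {n : Type*} [Fintype n] [DecidableEq n] (P : Matrix n n ℂ) : Prop :=
  P * P = 1

/-- `H` is PT-symmetric: `P T H = H P T` with `T` the complex conjugation, that is `P H̄ = H P`. -/
def IsPTSymmetric {n : Type*} [Fintype n] (P H : Matrix n n ℂ) : Prop :=
  P * conjMatrix H = H * P

/-- `H` is pseudo-Hermitian with metric `G` (equivalently `A = -iH` is `G`-Hamiltonian):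
`G` is Hermitian and non-singular and `H = -G⁻¹ S` with `S` Hermitian. -/
def IsPseudoHermitianWith {n : Type*} [Fintype n] [DecidableEq n] (G H : Matrix n n ℂ) : Prop :=
  G.IsHermitian ∧ IsUnit G ∧ ∃ S : Matrix n n ℂ, S.IsHermitian ∧ H = -(G⁻¹ * S)

/-- `H` is pseudo-Hermitian: it is so for some metric. -/
def IsPseudoHermitian {n : Type*} [Fintype n] [DecidableEq n] (H : Matrix n n ℂ) : Prop :=
  ∃ G : Matrix n n ℂ, IsPseudoHermitianWith G H

/-- The action `ψ* G ψ` of `ψ` (a real number, since `G` is Hermitian). -/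
noncomputable def action {n : Type*} [Fintype n] (G : Matrix n n ℂ) (ψ : n → ℂ) : ℝ :=
  (star ψ ⬝ᵥ G.mulVec ψ).re

/-- `μ` is an eigenvalue of `H`. -/
def IsEigenvalue {n : Type*} [Fintype n] [DecidableEq n] (H : Matrix n n ℂ) (μ : ℂ) : Prop :=
  Module.End.HasEigenvalue (Matrix.toLin' H) μ

/-- `ψ` is an eigenmode (a nonzero eigenvector) of `H` with eigenvalue `μ`. -/
def IsEigenmode {n : Type*} [Fintype n] [DecidableEq n] (H : Matrix n n ℂ) (μ : ℂ)
    (ψ : n → ℂ) : Prop :=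
  Module.End.HasEigenvector (Matrix.toLin' H) μ ψ

/-- The real eigenvalue `l` is of the first kind: all its eigenmodes have positive action. -/
def IsFirstKind {n : Type*} [Fintype n] [DecidableEq n] (G H : Matrix n n ℂ) (l : ℝ) : Prop :=
  IsEigenvalue H l ∧ ∀ ψ : n → ℂ, IsEigenmode H l ψ → 0 < action G ψ

/-- The real eigenvalue `l` is of the second kind: all its eigenmodes have negative action. -/
def IsSecondKind {n : Type*} [Fintype n] [DecidableEq n] (G H : Matrix n n ℂ) (l : ℝ) : Prop :=
  IsEigenvalue H l ∧ ∀ ψ : n → ℂ, IsEigenmode H l ψ → action G ψ < 0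

/-- The real eigenvalue `l` is definite: it is of the first or of the second kind. -/
def IsDefinite {n : Type*} [Fintype n] [DecidableEq n] (G H : Matrix n n ℂ) (l : ℝ) : Prop :=
  IsFirstKind G H l ∨ IsSecondKind G H l

/-- The real number `l` is an eigenvalue of mixed kind: it has an eigenmode of zero action. -/
def IsMixedKind {n : Type*} [Fintype n] [DecidableEq n] (G H : Matrix n n ℂ) (l : ℝ) : Prop :=
  ∃ ψ : n → ℂ, IsEigenmode H l ψ ∧ action G ψ = 0

/-- The symmetry is unbroken at `H`: all eigenvalues of `H` are real. -/
def IsUnbroken {n : Type*} [Fintype n] [DecidableEq n] (H : Matrix n n ℂ) : Prop :=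
  ∀ μ : ℂ, IsEigenvalue H μ → μ.im = 0

/-- The symmetry of the family `H` breaks at the parameter `x₀`: it is unbroken at `x₀`, but
non-real eigenvalues occur at parameters arbitrarily close to `x₀`. -/
def BreaksAt {n X : Type*} [Fintype n] [DecidableEq n] [TopologicalSpace X]
    (H : X → Matrix n n ℂ) (x₀ : X) : Prop :=
  IsUnbroken (H x₀) ∧ ∃ᶠ x in 𝓝 x₀, ¬ IsUnbroken (H x)

/-- The symmetry of the family `H` breaks at `x₀` at the point `l` of the real axis: at parameters
arbitrarily close to `x₀` there are non-real eigenvalues arbitrarily close to `l`. -/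
def BreaksAtPoint {n X : Type*} [Fintype n] [DecidableEq n] [TopologicalSpace X]
    (H : X → Matrix n n ℂ) (x₀ : X) (l : ℝ) : Prop :=
  ∀ ε : ℝ, 0 < ε → ∃ᶠ x in 𝓝 x₀, ∃ μ : ℂ, IsEigenvalue (H x) μ ∧ μ.im ≠ 0 ∧ ‖μ - l‖ < ε

/-- `H` is strongly stable in the parameter space `W`: all matrices of `W` in a neighbourhood
of `H` have only real eigenvalues. -/
def IsStronglyStable {n : Type*} [Fintype n] [DecidableEq n]
    (W : Set (Matrix n n ℂ)) (H : Matrix n n ℂ) : Prop :=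
  ∀ᶠ H' in 𝓝[W] H, IsUnbroken H'

/-- `γ` is a continuous curve in `W` through `H` (at time `0`) along which the symmetry breaks
at the real number `l`: up to time `0` the eigenvalues near `l` are real (and all eigenvalues are
real if those of `H` are), and at all later times there is a non-real eigenvalue `μ t`, which
emanates from `l`. -/
structure IsBreakingCurve {n : Type*} [Fintype n] [DecidableEq n]
    (W : Set (Matrix n n ℂ)) (H : Matrix n n ℂ) (l : ℝ) (γ : ℝ → Matrix n n ℂ) : Prop where
  continuous : Continuous γ
  mem : ∀ t, γ t ∈ W
  through : γ 0 = H
  real_before : ∃ ε : ℝ, 0 < ε ∧ ∀ t ≤ 0, ∀ μ : ℂ, IsEigenvalue (γ t) μ → ‖μ - l‖ < ε → μ.im = 0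
  unbroken_before : IsUnbroken H → ∀ t ≤ 0, IsUnbroken (γ t)
  broken_after : ∃ μ : ℝ → ℂ, (∀ t, 0 < t → IsEigenvalue (γ t) (μ t) ∧ (μ t).im ≠ 0) ∧
    Tendsto μ (𝓝[>] 0) (𝓝 (l : ℂ))

/-- The parameter space of all matrices that are pseudo-Hermitian with metric `G`. -/
def pseudoHermitianSpace {n : Type*} [Fintype n] [DecidableEq n] (G : Matrix n n ℂ) :
    Set (Matrix n n ℂ) :=
  {H | IsPseudoHermitianWith G H}

/-- The parameter space of all matrices that are PT-symmetric with parity `P` and pseudo-Hermitian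
with metric `G`. -/
def ptSpace {n : Type*} [Fintype n] [DecidableEq n] (P G : Matrix n n ℂ) :
    Set (Matrix n n ℂ) :=
  {H | IsPTSymmetric P H ∧ IsPseudoHermitianWith G H}

/-- The metric `G` is compatible with `PT`: `P* G P = Ḡ`, which says that the indefinite inner
product `⟨x, y⟩ = x* G y` satisfies `⟨PT x, PT y⟩ = conj ⟨x, y⟩`. -/
def IsCompatible {n : Type*} [Fintype n] (P G : Matrix n n ℂ) : Prop :=
  P.conjTranspose * G * P = conjMatrix G

end PTKrein

/-!
A pseudo-Hermitian `H` is self-adjoint for the indefinite inner product `[x, y] = x* G y`. Three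
observations about this product carry the theorem.

* *Signs.* Eigenvectors to non-real eigenvalues have zero action, and the action takes both signs
  on a subspace only if it vanishes at a nonzero vector there. So definite eigenvalues are
  the eigenvalues that are not of mixed kind (`isDefinite_iff`). At such an eigenvalue there are no
  Jordan chains (`maxGenEigenspace_eq_eigenspace`), whereas at a mixed one the generalized
  eigenspace, being nondegenerate, contains vectors of both signs (`exists_pos_neg_of_isMixedKind`).
* *Limits.* By compactness of the unit sphere, a limit of non-real eigenvalues of pseudo-Hermitian
  matrices is an eigenvalue with an eigenvector of zero action
  (`NonrealAccumulate.isMixedKind`). This proves that the symmetry breaks only at mixed eigenvalues,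
  along a family, along a curve, and in a space of matrices.
* *Perturbations.* Conversely, a mixed eigenvalue `l` with eigenvector `ψ` of zero action can be
  moved off the real axis, whatever the Jordan structure. Without further symmetry this takes a
  perturbation `K` of rank two with `K ψ = i ψ` (`IsMixedKind.exists_isBreakingCurve`).
  With a real parity operator and a compatible metric, a change of basis (`realFrame`) makes `H` and
  `G` real, and `K` has to be real. There is then a real eigenvector `ψ` of zero action and
  an independent `b` with `H b = l b + k ψ`, `k ≥ 0`. Correcting `ψ + i t b` by a real vector of
  order `t²` gives a vector of zero action, and a vector of zero action that is nearly an
  eigenvector for a nearby non-real number is an eigenvector of a nearby matrix with the same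
  symmetries (`exists_real_perturbation`).

The existence of metrics rests on the fact that a square matrix over a field is intertwined with its
transpose by a symmetric invertible matrix (`exists_symm_intertwiner`), which follows from the
structure theorem for modules over `K[X]`.
-/

namespace PTKrein

/-! ### The indefinite inner product of a metric -/

section InnerProduct

variable {n : Type*} [Fintype n]

/-- The indefinite inner product `x* G y`, antilinear in `x` and linear in `y`. -/
noncomputable def innerG (G : Matrix n n ℂ) (x y : n → ℂ) : ℂ :=
  star x ⬝ᵥ G.mulVec y

variable (G : Matrix n n ℂ) (x y z : n → ℂ) (c : ℂ)

lemma innerG_add_left : innerG G (x + y) z = innerG G x z + innerG G y z := by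
  simp [innerG, add_dotProduct]

lemma innerG_add_right : innerG G x (y + z) = innerG G x y + innerG G x z := by
  simp [innerG, Matrix.mulVec_add, dotProduct_add]

lemma innerG_smul_left : innerG G (c • x) y = star c * innerG G x y := by
  simp [innerG, smul_dotProduct]

lemma innerG_smul_right : innerG G x (c • y) = c * innerG G x y := by
  simp [innerG, Matrix.mulVec_smul, dotProduct_smul]

lemma innerG_sub_left : innerG G (x - y) z = innerG G x z - innerG G y z := by
  simp [innerG, sub_dotProduct]

lemma innerG_sub_right : innerG G x (y - z) = innerG G x y - innerG G x z := by
  simp [innerG, Matrix.mulVec_sub, dotProduct_sub]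

lemma innerG_zero_right : innerG G z 0 = 0 := by
  simp [innerG]

variable {G}

lemma star_innerG (hG : G.IsHermitian) : star (innerG G x y) = innerG G y x := by
  rw [innerG, innerG, Matrix.star_dotProduct, star_star, Matrix.star_mulVec, hG.eq,
    ← Matrix.dotProduct_mulVec, dotProduct_comm]

lemma innerG_self (hG : G.IsHermitian) : innerG G x x = (action G x : ℂ) := by
  have h := star_innerG x x hG
  exact (Complex.conj_eq_iff_re.mp h).symm

variable {x} in
lemma exists_innerG_eq_one [DecidableEq n] (hG : IsUnit G) (hH : G.IsHermitian) (hx : x ≠ 0) :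
    ∃ y, innerG G y x = 1 := by
  have hd := (Matrix.isUnit_iff_isUnit_det G).mp hG
  have h0 : star x ⬝ᵥ x ≠ 0 := by
    open ComplexOrder in exact dotProduct_star_self_eq_zero.not.mpr hx
  have h1 : innerG G (G⁻¹.mulVec x) x = star x ⬝ᵥ x := by
    rw [innerG, Matrix.star_mulVec, hH.inv.eq, ← Matrix.dotProduct_mulVec, Matrix.mulVec_mulVec,
      Matrix.nonsing_inv_mul G hd, Matrix.one_mulVec]
  exact ⟨star (star x ⬝ᵥ x)⁻¹ • G⁻¹.mulVec x, by
    rw [innerG_smul_left, star_star, h1, inv_mul_cancel₀ h0]⟩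

lemma action_add (hG : G.IsHermitian) :
    action G (x + y) = action G x + 2 * (innerG G x y).re + action G y := by
  have h := congrArg Complex.re (star_innerG x y hG)
  have e : ∀ v, action G v = (innerG G v v).re := fun v => rfl
  rw [e, innerG_add_left, innerG_add_right, innerG_add_right]
  simp only [Complex.add_re, e, Complex.star_def, Complex.conj_re] at *
  rw [← h]; ring

lemma action_smul : action G (c • x) = Complex.normSq c * action G x := by
  change (innerG G (c • x) (c • x)).re = _ * (innerG G x x).re
  rw [innerG_smul_left, innerG_smul_right, ← mul_assoc, Complex.star_def, mul_comm _ c,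
    Complex.mul_conj, Complex.re_ofReal_mul]

end InnerProduct

/-- A real quadratic function with values of opposite sign at `0` and at infinity has a zero. -/
lemma exists_real_quadratic_zero {p q r : ℝ} (hp : 0 < p) (hr : r < 0) :
    ∃ s : ℝ, p + s * q + s ^ 2 * r = 0 := by
  obtain ⟨s, hs⟩ := exists_quadratic_eq_zero (a := r) (b := q) (c := p) hr.ne
    ⟨√(discrim r q p), (Real.mul_self_sqrt (by unfold discrim; nlinarith [sq_nonneg q])).symm⟩
  exact ⟨s, by linarith⟩

/-! ### Definite and mixed eigenvalues -/

section Kinds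

variable {n : Type*} [Fintype n] [DecidableEq n] {G H : Matrix n n ℂ}

lemma isPseudoHermitianWith_iff :
    IsPseudoHermitianWith G H ↔ G.IsHermitian ∧ IsUnit G ∧ (G * H).IsHermitian := by
  refine and_congr_right fun hG => and_congr_right fun hu => ?_
  have hd := (Matrix.isUnit_iff_isUnit_det G).mp hu
  constructor
  · rintro ⟨S, hS, rfl⟩
    rw [mul_neg, ← mul_assoc, Matrix.mul_nonsing_inv G hd, one_mul]
    exact hS.neg
  · intro h
    exact ⟨-(G * H), h.neg, by
      rw [mul_neg, neg_neg, ← mul_assoc, Matrix.nonsing_inv_mul G hd, one_mul]⟩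

lemma innerG_mulVec_left (h : IsPseudoHermitianWith G H) (x y : n → ℂ) :
    innerG G (H.mulVec x) y = innerG G x (H.mulVec y) := by
  obtain ⟨hG, -, hGH⟩ := isPseudoHermitianWith_iff.mp h
  have e : H.conjTranspose * G = G * H := by
    rw [← hGH.eq, Matrix.conjTranspose_mul, hG.eq]
  rw [innerG, innerG, Matrix.star_mulVec, ← Matrix.dotProduct_mulVec, Matrix.mulVec_mulVec, e,
    Matrix.mulVec_mulVec]

lemma isEigenmode_iff {μ : ℂ} {ψ : n → ℂ} :
    IsEigenmode H μ ψ ↔ H.mulVec ψ = μ • ψ ∧ ψ ≠ 0 := by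
  rw [IsEigenmode, Module.End.hasEigenvector_iff, Module.End.mem_eigenspace_iff,
    Matrix.toLin'_apply]

lemma isEigenvalue_iff {μ : ℂ} :
    IsEigenvalue H μ ↔ ∃ ψ, H.mulVec ψ = μ • ψ ∧ ψ ≠ 0 :=
  ⟨fun h => (h.exists_hasEigenvector).imp fun _ => isEigenmode_iff.mp,
    fun ⟨_, h⟩ => Module.End.hasEigenvalue_of_hasEigenvector (isEigenmode_iff.mpr h)⟩

lemma IsEigenmode.isEigenvalue {μ : ℂ} {ψ : n → ℂ} (h : IsEigenmode H μ ψ) : IsEigenvalue H μ :=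
  Module.End.hasEigenvalue_of_hasEigenvector h

lemma IsMixedKind.isEigenvalue {l : ℝ} (h : IsMixedKind G H l) : IsEigenvalue H l :=
  let ⟨_, h, _⟩ := h
  h.isEigenvalue

/-- Self-adjointness gives `(μ - conj μ) ψ* G ψ = 0`. -/
lemma action_eq_zero_of_im_ne_zero (h : IsPseudoHermitianWith G H) {μ : ℂ} {ψ : n → ℂ}
    (hψ : H.mulVec ψ = μ • ψ) (hμ : μ.im ≠ 0) : action G ψ = 0 := by
  have e := innerG_mulVec_left h ψ ψ
  rw [hψ, innerG_smul_left, innerG_smul_right, innerG_self ψ h.1] at e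
  have e' := congrArg Complex.im e
  simp only [Complex.star_def, Complex.im_mul_ofReal, Complex.conj_im] at e'
  exact (mul_eq_zero.mp (by linarith : μ.im * action G ψ = 0)).resolve_left hμ

omit [DecidableEq n] in
/-- On the real line through a vector of positive and a vector of negative action, the action
vanishes at a nonzero vector. -/
lemma exists_action_eq_zero (hG : G.IsHermitian) {u v : n → ℂ} (hu : 0 < action G u)
    (hv : action G v < 0) : ∃ s : ℝ, action G (u + (s : ℂ) • v) = 0 ∧ u + (s : ℂ) • v ≠ 0 := by
  obtain ⟨s, hs⟩ := exists_real_quadratic_zero (q := 2 * (innerG G u v).re) hu hv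
  refine ⟨s, ?_, fun h => ?_⟩
  · rw [action_add _ _ hG, innerG_smul_right, action_smul, Complex.re_ofReal_mul,
      Complex.normSq_ofReal]
    linarith
  · have : u = (((-s : ℝ)) : ℂ) • v := by
      rw [eq_neg_of_add_eq_zero_left h]; simp
    rw [this, action_smul, Complex.normSq_ofReal] at hu
    nlinarith [mul_self_nonneg s]

omit [DecidableEq n] in
lemma action_pos_or_neg_of_ne_zero (hG : G.IsHermitian) (E : Submodule ℂ (n → ℂ))
    (h : ∀ v ∈ E, v ≠ 0 → action G v ≠ 0) :
    (∀ v ∈ E, v ≠ 0 → 0 < action G v) ∨ (∀ v ∈ E, v ≠ 0 → action G v < 0) := by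
  by_contra! hc
  obtain ⟨⟨v, hv, hv0, hva⟩, u, hu, hu0, hua⟩ := hc
  obtain ⟨s, hs, hs0⟩ := exists_action_eq_zero hG (hua.lt_of_ne (h u hu hu0).symm)
    (hva.lt_of_ne (h v hv hv0))
  exact h _ (E.add_mem hu (E.smul_mem _ hv)) hs0 hs

/-- Definite eigenvalues are those eigenvalues that are not of mixed kind. -/
lemma isDefinite_iff (hG : G.IsHermitian) {l : ℝ} :
    IsDefinite G H l ↔ IsEigenvalue H l ∧ ¬ IsMixedKind G H l := by
  constructor
  · rintro (⟨h1, h2⟩ | ⟨h1, h2⟩) <;> refine ⟨h1, fun ⟨ψ, hψ, h0⟩ => ?_⟩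
    exacts [(h2 ψ hψ).ne' h0, (h2 ψ hψ).ne h0]
  · rintro ⟨h1, h2⟩
    have h3 := action_pos_or_neg_of_ne_zero hG (Module.End.eigenspace (Matrix.toLin' H) (l : ℂ))
      fun v hv hv0 h0 => h2 ⟨v, ⟨hv, hv0⟩, h0⟩
    exact h3.imp (fun h => ⟨h1, fun ψ hψ => h ψ hψ.1 hψ.2⟩)
      (fun h => ⟨h1, fun ψ hψ => h ψ hψ.1 hψ.2⟩)

end Kinds

/-! ### The sign of the action on generalized eigenspaces -/

section GeneralizedEigenspace

variable {n : Type*} [Fintype n] [DecidableEq n] {G H : Matrix n n ℂ} {l : ℝ}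

lemma innerG_toLin'_sub_left (h : IsPseudoHermitianWith G H) (x y : n → ℂ) :
    innerG G ((Matrix.toLin' H - (l : ℂ) • (1 : Module.End ℂ (n → ℂ))) x) y =
      innerG G x ((Matrix.toLin' H - (l : ℂ) • (1 : Module.End ℂ (n → ℂ))) y) := by
  simp only [LinearMap.sub_apply, Matrix.toLin'_apply, LinearMap.smul_apply, Module.End.one_apply,
    innerG_sub_left, innerG_sub_right, innerG_smul_left, innerG_smul_right,
    innerG_mulVec_left h, Complex.star_def, Complex.conj_ofReal]

lemma innerG_toLin'_sub_pow_left (h : IsPseudoHermitianWith G H) (k : ℕ) (x y : n → ℂ) :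
    innerG G (((Matrix.toLin' H - (l : ℂ) • (1 : Module.End ℂ (n → ℂ))) ^ k) x) y =
      innerG G x (((Matrix.toLin' H - (l : ℂ) • (1 : Module.End ℂ (n → ℂ))) ^ k) y) := by
  induction k generalizing x y with
  | zero => rfl
  | succ k ih =>
    rw [pow_succ, Module.End.mul_apply, ih, innerG_toLin'_sub_left h, ← Module.End.mul_apply,
      ← pow_succ', pow_succ]

/-- A Jordan chain of length two would give an eigenvector that lies both in the range and in the
kernel of `H - l`, and therefore has zero action. -/
lemma maxGenEigenspace_eq_eigenspace (h : IsPseudoHermitianWith G H)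
    (hl : ¬ IsMixedKind G H l) :
    Module.End.maxGenEigenspace (Matrix.toLin' H) (l : ℂ) =
      Module.End.eigenspace (Matrix.toLin' H) (l : ℂ) := by
  set N := Matrix.toLin' H - (l : ℂ) • (1 : Module.End ℂ (n → ℂ)) with hN
  have key : ∀ v, N (N v) = 0 → N v = 0 := by
    intro v hv
    by_contra h0
    refine hl ⟨N v, ⟨?_, h0⟩, ?_⟩
    · rw [Module.End.mem_eigenspace_iff, ← sub_eq_zero]
      exact hv
    · change (innerG G (N v) (N v)).re = 0
      rw [innerG_toLin'_sub_left h, ← hN, hv, innerG_zero_right, Complex.zero_re]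
  have key2 : ∀ (k : ℕ) v, (N ^ (k + 1)) v = 0 → N v = 0 := by
    intro k
    induction k with
    | zero => intro v hv; simpa using hv
    | succ k ih =>
      intro v hv
      rw [pow_succ, Module.End.mul_apply] at hv
      exact key v (ih _ hv)
  refine le_antisymm (fun v hv => ?_) (fun v hv => ?_)
  · obtain ⟨k, hk⟩ := Module.End.mem_maxGenEigenspace _ _ _ |>.mp hv
    rw [Module.End.mem_eigenspace_iff, ← sub_eq_zero]
    refine key2 k v ?_
    rw [pow_succ', Module.End.mul_apply]
    have : (N ^ k) v = 0 := hk
    rw [this, map_zero]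
  · refine (Module.End.mem_maxGenEigenspace _ _ _).mpr ⟨1, ?_⟩
    rw [Module.End.mem_eigenspace_iff, ← sub_eq_zero] at hv
    rw [pow_one]
    exact hv

/-- The generalized eigenspace is nondegenerate, since it is orthogonal to its complement in the
Fitting decomposition; so an eigenvector `ψ` of zero action has a partner `φ` with `[φ, ψ] ≠ 0`
there, and the action takes both signs on the span of `ψ` and `φ`. -/
lemma exists_pos_neg_of_isMixedKind (h : IsPseudoHermitianWith G H) (hl : IsMixedKind G H l) :
    ∃ v ∈ Module.End.maxGenEigenspace (Matrix.toLin' H) (l : ℂ),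
    ∃ w ∈ Module.End.maxGenEigenspace (Matrix.toLin' H) (l : ℂ),
      0 < action G v ∧ action G w < 0 := by
  obtain ⟨ψ, hψ, hψ0⟩ := hl
  set E := Module.End.maxGenEigenspace (Matrix.toLin' H) (l : ℂ) with hE
  set N := Matrix.toLin' H - (l : ℂ) • (1 : Module.End ℂ (n → ℂ)) with hN
  have hNψ : N ψ = 0 := by
    have := hψ.1
    rw [Module.End.mem_eigenspace_iff, ← sub_eq_zero] at this
    exact this
  have hψE : ψ ∈ E := (Module.End.mem_maxGenEigenspace _ _ _).mpr ⟨1, by rw [pow_one]; exact hNψ⟩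
  obtain ⟨φ, hφE, hφ⟩ : ∃ φ ∈ E, innerG G φ ψ ≠ 0 := by
    by_contra! hc
    obtain ⟨y, hy⟩ := exists_innerG_eq_one h.2.1 h.1 hψ.2
    have hco := LinearMap.isCompl_iSup_ker_pow_iInf_range_pow N
    obtain ⟨u, hu, v, hv, rfl⟩ := Submodule.mem_sup.mp
      (hco.sup_eq_top ▸ Submodule.mem_top (x := y))
    have hu' : u ∈ E :=
      (iSup_le fun k x hx => (Module.End.mem_maxGenEigenspace _ _ _).mpr ⟨k, hx⟩ :
        ⨆ k, LinearMap.ker (N ^ k) ≤ E) hu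
    obtain ⟨w, rfl⟩ := (Submodule.mem_iInf _).mp hv 1
    rw [innerG_add_left, hc u hu', zero_add, innerG_toLin'_sub_pow_left h, pow_one, ← hN, hNψ,
      innerG_zero_right] at hy
    exact zero_ne_one hy
  have key : ∀ r : ℝ, ∃ v ∈ E, action G v = action G φ + r := by
    intro r
    refine ⟨φ + ((r / 2 : ℝ) / innerG G φ ψ) • ψ, E.add_mem hφE (E.smul_mem _ hψE), ?_⟩
    rw [action_add _ _ h.1, action_smul, hψ0, mul_zero, add_zero, innerG_smul_right,
      div_mul_cancel₀ _ hφ, Complex.ofReal_re]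
    ring
  obtain ⟨v, hv, hv'⟩ := key (1 - action G φ)
  obtain ⟨w, hw, hw'⟩ := key (-1 - action G φ)
  exact ⟨v, hv, w, hw, by linarith, by linarith⟩

lemma isMixedKind_of_exists_pos_neg (h : IsPseudoHermitianWith G H)
    (hl : ∃ v ∈ Module.End.maxGenEigenspace (Matrix.toLin' H) (l : ℂ),
      ∃ w ∈ Module.End.maxGenEigenspace (Matrix.toLin' H) (l : ℂ),
        0 < action G v ∧ action G w < 0) : IsMixedKind G H l := by
  by_contra hc
  rw [maxGenEigenspace_eq_eigenspace h hc] at hl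
  obtain ⟨v, hv, w, hw, hv0, hw0⟩ := hl
  obtain ⟨s, hs, hs0⟩ := exists_action_eq_zero h.1 hv0 hw0
  exact hc ⟨_, ⟨Submodule.add_mem _ hv (Submodule.smul_mem _ _ hw), hs0⟩, hs⟩

lemma two_le_rootMultiplicity (h : IsPseudoHermitianWith G H) (hl : IsMixedKind G H l) :
    2 ≤ H.charpoly.rootMultiplicity (l : ℂ) := by
  obtain ⟨v, hv, w, hw, hv0, hw0⟩ := exists_pos_neg_of_isMixedKind h hl
  rw [← Matrix.charpoly_toLin', ← LinearMap.finrank_maxGenEigenspace_eq]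
  by_contra! hc
  -- on a space of dimension at most one, the action has one sign
  have hw1 : (⟨w, hw⟩ : Module.End.maxGenEigenspace (Matrix.toLin' H) (l : ℂ)) ≠ 0 := by
    intro h0
    rw [Submodule.mk_eq_zero] at h0
    simp [h0, action] at hw0
  have : Nontrivial (Module.End.maxGenEigenspace (Matrix.toLin' H) (l : ℂ)) := ⟨_, _, hw1⟩
  obtain ⟨c, hc⟩ := (finrank_eq_one_iff_of_nonzero' _ hw1).mp
    (le_antisymm (Nat.lt_succ_iff.mp hc) Module.finrank_pos) ⟨v, hv⟩
  have hcv : c • w = v := congrArg Subtype.val hc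
  rw [← hcv, action_smul] at hv0
  exact (mul_nonpos_of_nonneg_of_nonpos (Complex.normSq_nonneg c) hw0.le).not_gt hv0

end GeneralizedEigenspace

/-! ### Limits of non-real eigenvalues -/

section Limits

variable {n X : Type*} [Fintype n] [DecidableEq n]

/-- Non-real eigenvalues of the family `H` accumulate at `l` along the filter `F` of parameters. -/
def NonrealAccumulate (H : X → Matrix n n ℂ) (F : Filter X) (l : ℝ) : Prop :=
  ∀ ε : ℝ, 0 < ε → ∃ᶠ x in F, ∃ μ : ℂ, IsEigenvalue (H x) μ ∧ μ.im ≠ 0 ∧ ‖μ - l‖ < ε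

/-- A limit of eigenvalues with eigenvectors of zero action is again one, because the eigenvectors
can be normalized and the unit sphere is compact. -/
lemma exists_isEigenmode_of_tendsto {F : Filter X} [F.NeBot] {G H : X → Matrix n n ℂ} {μ : X → ℂ}
    {G₀ H₀ : Matrix n n ℂ} {μ₀ : ℂ} (hG : Tendsto G F (𝓝 G₀)) (hH : Tendsto H F (𝓝 H₀))
    (hμ : Tendsto μ F (𝓝 μ₀))
    (h : ∀ᶠ x in F, ∃ ψ, IsEigenmode (H x) (μ x) ψ ∧ action (G x) ψ = 0) :
    ∃ ψ, IsEigenmode H₀ μ₀ ψ ∧ action G₀ ψ = 0 := by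
  have h' : ∀ᶠ x in F, ∃ ψ : n → ℂ, ψ ∈ Metric.sphere (0 : n → ℂ) 1 ∧
      (H x).mulVec ψ = μ x • ψ ∧ action (G x) ψ = 0 := by
    filter_upwards [h] with x ⟨ψ, hψ, h0⟩
    obtain ⟨h1, h2⟩ := isEigenmode_iff.mp hψ
    have hn : ‖ψ‖ ≠ 0 := norm_ne_zero_iff.mpr h2
    refine ⟨((‖ψ‖⁻¹ : ℝ) : ℂ) • ψ, ?_, ?_, ?_⟩
    · rw [mem_sphere_zero_iff_norm, norm_smul, Complex.norm_real, norm_inv, norm_norm,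
        inv_mul_cancel₀ hn]
    · rw [Matrix.mulVec_smul, h1, smul_comm]
    · rw [action_smul, h0, mul_zero]
  have h'' : ∃ ψ : X → n → ℂ, ∀ᶠ x in F, ψ x ∈ Metric.sphere (0 : n → ℂ) 1 ∧
      (H x).mulVec (ψ x) = μ x • ψ x ∧ action (G x) (ψ x) = 0 := h'.choice
  obtain ⟨ψ, hψ⟩ := h''
  set U := Ultrafilter.of F
  have hU : (U : Filter X) ≤ F := Ultrafilter.of_le F
  obtain ⟨ψ₀, hψ₀, hlim⟩ := (isCompact_sphere (0 : n → ℂ) 1).ultrafilter_le_nhds (U.map ψ)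
    (le_principal_iff.mpr ((hψ.filter_mono hU).mono fun x hx => hx.1))
  have hlim : Tendsto ψ U (𝓝 ψ₀) := hlim
  have hmul : Continuous fun p : Matrix n n ℂ × (n → ℂ) => p.1.mulVec p.2 :=
    continuous_fst.matrix_mulVec continuous_snd
  have hact : Continuous fun p : Matrix n n ℂ × (n → ℂ) => action p.1 p.2 :=
    Complex.continuous_re.comp (continuous_snd.star.dotProduct hmul)
  refine ⟨ψ₀, isEigenmode_iff.mpr ⟨?_, ?_⟩, ?_⟩
  · refine tendsto_nhds_unique_of_eventuallyEq
      ((hmul.tendsto (H₀, ψ₀)).comp ((hH.mono_left hU).prodMk_nhds hlim))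
      ((hμ.mono_left hU).smul hlim) ?_
    filter_upwards [hψ.filter_mono hU] with x hx using hx.2.1
  · exact Metric.ne_of_mem_sphere hψ₀ one_ne_zero
  · refine tendsto_nhds_unique_of_eventuallyEq
      ((hact.tendsto (G₀, ψ₀)).comp ((hG.mono_left hU).prodMk_nhds hlim)) tendsto_const_nhds ?_
    filter_upwards [hψ.filter_mono hU] with x hx using hx.2.2

variable {F : Filter X} {G H : X → Matrix n n ℂ} {G₀ H₀ : Matrix n n ℂ}

lemma exists_isEigenmode_action_eq_zero {G H : Matrix n n ℂ} (h : IsPseudoHermitianWith G H)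
    {μ : ℂ} (hμ : IsEigenvalue H μ) (hi : μ.im ≠ 0) :
    ∃ ψ, IsEigenmode H μ ψ ∧ action G ψ = 0 := by
  obtain ⟨ψ, hψ, h0⟩ := isEigenvalue_iff.mp hμ
  exact ⟨ψ, isEigenmode_iff.mpr ⟨hψ, h0⟩, action_eq_zero_of_im_ne_zero h hψ hi⟩

lemma NonrealAccumulate.isMixedKind {l : ℝ} (hG : Tendsto G F (𝓝 G₀)) (hH : Tendsto H F (𝓝 H₀))
    (hGH : ∀ᶠ x in F, IsPseudoHermitianWith (G x) (H x)) (h : NonrealAccumulate H F l) :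
    IsMixedKind G₀ H₀ l := by
  set T : Set (X × ℂ) :=
    {p | IsPseudoHermitianWith (G p.1) (H p.1) ∧ IsEigenvalue (H p.1) p.2 ∧ p.2.im ≠ 0}
  have hT : ∃ᶠ p in F ×ˢ 𝓝 (l : ℂ), p ∈ T := by
    refine (F.basis_sets.prod Metric.nhds_basis_ball).frequently_iff.mpr ?_
    rintro ⟨s, ε⟩ ⟨hs, hε⟩
    obtain ⟨x, ⟨μ, h1, h2, h3⟩, h4, h5⟩ := ((h ε hε).and_eventually (hGH.and hs)).exists
    exact ⟨(x, μ), ⟨h5, by simpa [dist_eq_norm] using h3⟩, h4, h1, h2⟩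
  have := frequently_mem_iff_neBot.mp hT
  have hle : F ×ˢ 𝓝 (l : ℂ) ⊓ 𝓟 T ≤ F ×ˢ 𝓝 (l : ℂ) := inf_le_left
  refine exists_isEigenmode_of_tendsto (F := F ×ˢ 𝓝 (l : ℂ) ⊓ 𝓟 T)
    ((hG.comp tendsto_fst).mono_left hle) ((hH.comp tendsto_fst).mono_left hle)
    ((tendsto_snd : Tendsto Prod.snd (F ×ˢ 𝓝 (l : ℂ)) _).mono_left hle) ?_
  filter_upwards [(mem_principal_self T : T ∈ 𝓟 T) |> mem_inf_of_right] with p hp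
  exact exists_isEigenmode_action_eq_zero hp.1 hp.2.1 hp.2.2

lemma norm_le_of_isEigenvalue {M : Matrix n n ℂ} {μ : ℂ} (h : IsEigenvalue M μ) :
    ‖μ‖ ≤ ∑ i, ∑ j, ‖M i j‖ := by
  obtain ⟨ψ, hψ, h0⟩ := isEigenvalue_iff.mp h
  refine le_of_mul_le_mul_right ?_ (norm_pos_iff.mpr h0)
  rw [← norm_smul, ← hψ]
  have hs : ∀ i, 0 ≤ ∑ j, ‖M i j‖ := fun i => Finset.sum_nonneg fun j _ => norm_nonneg _
  refine (pi_norm_le_iff_of_nonneg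
    (mul_nonneg (Finset.sum_nonneg fun i _ => hs i) (norm_nonneg _))).mpr fun i => ?_
  calc ‖(M.mulVec ψ) i‖ ≤ ∑ j, ‖M i j * ψ j‖ := norm_sum_le _ _
    _ ≤ ∑ j, ‖M i j‖ * ‖ψ‖ := Finset.sum_le_sum fun j _ => by
        rw [norm_mul]
        exact mul_le_mul_of_nonneg_left (norm_le_pi_norm ψ j) (norm_nonneg _)
    _ = (∑ j, ‖M i j‖) * ‖ψ‖ := (Finset.sum_mul _ _ _).symm
    _ ≤ _ := mul_le_mul_of_nonneg_right
        (Finset.single_le_sum (fun i _ => hs i) (Finset.mem_univ i)) (norm_nonneg _)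

/-- Eigenvalues stay bounded along a convergent family, so the non-real ones have a cluster point,
and this is an eigenvalue of the limit. -/
lemma exists_nonrealAccumulate (hH : Tendsto H F (𝓝 H₀)) (h₀ : IsUnbroken H₀)
    (h : ∃ᶠ x in F, ¬ IsUnbroken (H x)) : ∃ l : ℝ, NonrealAccumulate H F l := by
  set T : Set X := {x | ¬ IsUnbroken (H x)}
  have : (F ⊓ 𝓟 T).NeBot := frequently_mem_iff_neBot.mp h
  have hμ : ∀ᶠ x in F ⊓ 𝓟 T, ∃ μ : ℂ, IsEigenvalue (H x) μ ∧ μ.im ≠ 0 := by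
    filter_upwards [(mem_principal_self T : T ∈ 𝓟 T) |> mem_inf_of_right] with x hx
    simpa [T, IsUnbroken] using hx
  obtain ⟨μ, hμ⟩ := hμ.choice
  set U := Ultrafilter.of (F ⊓ 𝓟 T)
  have hU : (U : Filter X) ≤ F ⊓ 𝓟 T := Ultrafilter.of_le _
  have hUF : (U : Filter X) ≤ F := hU.trans inf_le_left
  have hcont : Continuous fun M : Matrix n n ℂ => ∑ i, ∑ j, ‖M i j‖ := by fun_prop
  have hb : ∀ᶠ x in (U : Filter X), μ x ∈ Metric.closedBall (0 : ℂ) (∑ i, ∑ j, ‖H₀ i j‖ + 1) := by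
    filter_upwards [hμ.filter_mono hU, (((hcont.tendsto H₀).comp hH).mono_left hUF).eventually
      (gt_mem_nhds (lt_add_one _))] with x hx hx'
    exact mem_closedBall_zero_iff.mpr ((norm_le_of_isEigenvalue hx.1).trans hx'.le)
  obtain ⟨z, -, hz⟩ := (isCompact_closedBall (0 : ℂ) _).ultrafilter_le_nhds (U.map μ)
    (le_principal_iff.mpr hb)
  have hz : Tendsto μ U (𝓝 z) := hz
  -- the limit of the eigenvalues is an eigenvalue; the zero form serves as a dummy metric
  obtain ⟨ψ, hψ, -⟩ := exists_isEigenmode_of_tendsto (F := (U : Filter X)) (G := fun _ => 0)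
    tendsto_const_nhds (hH.mono_left hUF) hz (by
      filter_upwards [hμ.filter_mono hU] with x hx
      obtain ⟨ψ, hψ⟩ := isEigenvalue_iff.mp hx.1
      exact ⟨ψ, isEigenmode_iff.mpr hψ, by simp [action]⟩)
  have hzr : ((z.re : ℝ) : ℂ) = z := Complex.ext rfl (h₀ z hψ.isEigenvalue).symm
  refine ⟨z.re, fun ε hε => ?_⟩
  have hev : ∀ᶠ x in (U : Filter X),
      ∃ μ : ℂ, IsEigenvalue (H x) μ ∧ μ.im ≠ 0 ∧ ‖μ - (z.re : ℝ)‖ < ε := by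
    filter_upwards [hμ.filter_mono hU, hz (Metric.ball_mem_nhds z hε)] with x hx hx'
    exact ⟨μ x, hx.1, hx.2, by rw [hzr, ← dist_eq_norm]; exact hx'⟩
  exact hev.frequently.filter_mono hUF

/-- Near an eigenvalue that is not of mixed kind, all eigenvalues of nearby Hamiltonians are
real. -/
lemma eventually_real_of_not_isMixedKind {l : ℝ} (hG : Tendsto G F (𝓝 G₀))
    (hH : Tendsto H F (𝓝 H₀)) (hGH : ∀ᶠ x in F, IsPseudoHermitianWith (G x) (H x))
    (hl : ¬ IsMixedKind G₀ H₀ l) :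
    ∃ ε : ℝ, 0 < ε ∧ ∀ᶠ x in F, ∀ μ : ℂ, IsEigenvalue (H x) μ → ‖μ - l‖ < ε → μ.im = 0 := by
  by_contra! hc
  refine hl (NonrealAccumulate.isMixedKind hG hH hGH fun ε hε => (hc ε hε).mono ?_)
  rintro x ⟨μ, h1, h2, h3⟩
  exact ⟨μ, h1, h3, h2⟩

lemma eventually_isUnbroken (hG : Tendsto G F (𝓝 G₀)) (hH : Tendsto H F (𝓝 H₀))
    (hGH : ∀ᶠ x in F, IsPseudoHermitianWith (G x) (H x)) (h₀ : IsUnbroken H₀)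
    (hm : ∀ l : ℝ, ¬ IsMixedKind G₀ H₀ l) : ∀ᶠ x in F, IsUnbroken (H x) := by
  by_contra hc
  obtain ⟨l, hl⟩ := exists_nonrealAccumulate hH h₀ (not_eventually.mp hc)
  exact hm l (hl.isMixedKind hG hH hGH)

end Limits

/-! ### Breaking curves -/

section Curves

variable {n : Type*} [Fintype n] [DecidableEq n] {G H : Matrix n n ℂ} {W : Set (Matrix n n ℂ)}
  {l : ℝ}

lemma exists_real_near (H : Matrix n n ℂ) (l : ℝ) :
    ∃ ε : ℝ, 0 < ε ∧ ∀ μ : ℂ, IsEigenvalue H μ → ‖μ - l‖ < ε → μ.im = 0 := by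
  have hfin : ({μ : ℂ | IsEigenvalue H μ} \ {(l : ℂ)}).Finite :=
    (Module.End.finite_hasEigenvalue (Matrix.toLin' H)).sdiff
  obtain ⟨ε, hε, hball⟩ := Metric.isOpen_iff.mp hfin.isClosed.isOpen_compl (l : ℂ)
    (fun h => h.2 rfl)
  refine ⟨ε, hε, fun μ hμ hd => ?_⟩
  by_contra hi
  refine hball (by rw [Metric.mem_ball, dist_eq_norm]; exact hd) ⟨hμ, fun h => hi ?_⟩
  rw [Set.mem_singleton_iff.mp h, Complex.ofReal_im]

/-- A curve on a short interval to the right of `0` extends to a breaking curve: it rests at `H` for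
negative times, and it stops after a short time. -/
lemma exists_isBreakingCurve_of_right {γ : ℝ → Matrix n n ℂ} {μ : ℝ → ℂ} (hH : H ∈ W)
    (hc : ∀ᶠ t in 𝓝 0, ContinuousAt γ t) (h0 : γ 0 = H)
    (hγ : ∀ᶠ t in 𝓝[>] 0, γ t ∈ W ∧ IsEigenvalue (γ t) (μ t) ∧ (μ t).im ≠ 0)
    (hμ : Tendsto μ (𝓝[>] 0) (𝓝 (l : ℂ))) : ∃ γ, IsBreakingCurve W H l γ := by
  obtain ⟨d, hd, hball⟩ := Metric.eventually_nhds_iff.mp (hc.and (eventually_nhdsWithin_iff.mp hγ))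
  set c : ℝ → ℝ := fun t => max 0 (min t (d / 2)) with hcdef
  have hcc : Continuous c := by fun_prop
  have hc0 : ∀ t, 0 ≤ c t := fun t => le_max_left _ _
  have hcd : ∀ t, dist (c t) 0 < d := fun t => by
    rw [Real.dist_0_eq_abs, abs_of_nonneg (hc0 t)]
    exact max_lt hd ((min_le_right _ _).trans_lt (half_lt_self hd))
  have hcneg : ∀ t ≤ 0, c t = 0 := fun t ht => max_eq_left ((min_le_left _ _).trans ht)
  have hcpos : ∀ t, 0 < t → 0 < c t := fun t ht => lt_max_of_lt_right (lt_min ht (half_pos hd))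
  have hγneg : ∀ t ≤ 0, γ (c t) = H := fun t ht => by rw [hcneg t ht, h0]
  refine ⟨γ ∘ c, ⟨?_, ?_, hγneg 0 le_rfl, ?_, ?_, ?_⟩⟩
  · exact continuous_iff_continuousAt.mpr fun t => (hball (hcd t)).1.comp hcc.continuousAt
  · intro t
    rcases (hc0 t).eq_or_lt with h | h
    · rw [Function.comp_apply, ← h, h0]
      exact hH
    · exact ((hball (hcd t)).2 h).1
  · obtain ⟨ε, hε, h⟩ := exists_real_near H l
    refine ⟨ε, hε, fun t ht => ?_⟩
    rw [Function.comp_apply, hγneg t ht]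
    exact h
  · intro h t ht
    rw [Function.comp_apply, hγneg t ht]
    exact h
  · refine ⟨μ ∘ c, fun t ht => ((hball (hcd t)).2 (hcpos t ht)).2, hμ.comp ?_⟩
    refine tendsto_nhdsWithin_iff.mpr ⟨?_, ?_⟩
    · have := hcc.tendsto 0
      rw [hcneg 0 le_rfl] at this
      exact this.mono_left nhdsWithin_le_nhds
    · filter_upwards [self_mem_nhdsWithin] with t ht using hcpos t ht

lemma IsBreakingCurve.isMixedKind {γ : ℝ → Matrix n n ℂ} (hG : W ⊆ pseudoHermitianSpace G)
    (h : IsBreakingCurve W H l γ) : IsMixedKind G H l := by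
  obtain ⟨μ, hμ, hlim⟩ := h.broken_after
  have hγ : Tendsto γ (𝓝[>] 0) (𝓝 H) :=
    h.through ▸ (h.continuous.tendsto 0).mono_left nhdsWithin_le_nhds
  refine NonrealAccumulate.isMixedKind tendsto_const_nhds hγ
    (Eventually.of_forall fun t => hG (h.mem t)) fun ε hε => Eventually.frequently ?_
  filter_upwards [self_mem_nhdsWithin, hlim (Metric.ball_mem_nhds _ hε)] with t ht ht'
  exact ⟨μ t, (hμ t ht).1, (hμ t ht).2, by rw [← dist_eq_norm]; exact ht'⟩

/-- In a space of pseudo-Hermitian matrices, strong stability is the absence of mixed eigenvalues as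
soon as each mixed eigenvalue admits a breaking curve. -/
lemma isStronglyStable_iff (hG : W ⊆ pseudoHermitianSpace G) (hH : H ∈ W)
    (hW : ∀ l : ℝ, IsMixedKind G H l → ∃ γ, IsBreakingCurve W H l γ) :
    IsStronglyStable W H ↔ IsUnbroken H ∧ ∀ l : ℝ, IsEigenvalue H l → IsDefinite G H l := by
  have hGH := hG hH
  constructor
  · intro hs
    refine ⟨hs.self_of_nhdsWithin hH, fun l hl => (isDefinite_iff hGH.1).mpr ⟨hl, fun hm => ?_⟩⟩
    obtain ⟨γ, hγ⟩ := hW l hm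
    obtain ⟨μ, hμ, -⟩ := hγ.broken_after
    have hlim : Tendsto γ (𝓝[>] 0) (𝓝[W] H) := tendsto_nhdsWithin_iff.mpr
      ⟨hγ.through ▸ (hγ.continuous.tendsto 0).mono_left nhdsWithin_le_nhds,
        Eventually.of_forall hγ.mem⟩
    obtain ⟨t, ht, ht'⟩ := ((hlim.eventually hs).and self_mem_nhdsWithin).exists
    exact (hμ t ht').2 (ht _ (hμ t ht').1)
  · rintro ⟨h1, h2⟩
    refine eventually_isUnbroken (G := fun _ => G) tendsto_const_nhds
      (tendsto_id'.mpr nhdsWithin_le_nhds) ?_ h1 fun l hl =>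
        ((isDefinite_iff hGH.1).mp (h2 l hl.isEigenvalue)).2 hl
    filter_upwards [self_mem_nhdsWithin] with M hM using hG hM

/-- For an eigenvector `ψ` of zero action and `φ` with `[φ, ψ] = 1`, the perturbation
`K x = i (ψ [φ, x] - φ [ψ, x])` is self-adjoint for `G` and `K ψ = i ψ`; so `H + t K` has the
eigenvalue `l + i t`. -/
lemma IsMixedKind.exists_isBreakingCurve (hH : IsPseudoHermitianWith G H)
    (hl : IsMixedKind G H l) : ∃ γ, IsBreakingCurve (pseudoHermitianSpace G) H l γ := by
  obtain ⟨ψ, hψ, hψ0⟩ := hl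
  obtain ⟨hHψ, hψne⟩ := isEigenmode_iff.mp hψ
  obtain ⟨φ, hφ⟩ := exists_innerG_eq_one hH.2.1 hH.1 hψne
  obtain ⟨hG, hu, hGH⟩ := isPseudoHermitianWith_iff.mp hH
  set K : Matrix n n ℂ := Complex.I • (Matrix.vecMulVec ψ (Matrix.vecMul (star φ) G) -
    Matrix.vecMulVec φ (Matrix.vecMul (star ψ) G)) with hK
  have hKψ : K.mulVec ψ = Complex.I • ψ := by
    have h1 : Matrix.vecMul (star φ) G ⬝ᵥ ψ = 1 := by rw [← Matrix.dotProduct_mulVec]; exact hφ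
    have h2 : Matrix.vecMul (star ψ) G ⬝ᵥ ψ = 0 := by
      rw [← Matrix.dotProduct_mulVec]
      exact (innerG_self ψ hG).trans (by rw [hψ0, Complex.ofReal_zero])
    rw [hK, Matrix.smul_mulVec, Matrix.sub_mulVec, Matrix.vecMulVec_mulVec,
      Matrix.vecMulVec_mulVec, h1, h2]
    simp
  have hGK : (G * K).IsHermitian := by
    have h1 : ∀ x, star (G.mulVec x) = Matrix.vecMul (star x) G := fun x => by
      rw [Matrix.star_mulVec, hG.eq]
    have h2 : ∀ x, star (Matrix.vecMul (star x) G) = G.mulVec x := fun x => by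
      rw [← h1, star_star]
    rw [Matrix.IsHermitian, hK, Matrix.mul_smul, Matrix.mul_sub, Matrix.mul_vecMulVec,
      Matrix.mul_vecMulVec, Matrix.conjTranspose_smul, Matrix.conjTranspose_sub,
      Matrix.conjTranspose_vecMulVec, Matrix.conjTranspose_vecMulVec, h1, h1, h2, h2,
      Complex.star_def, Complex.conj_I, neg_smul, ← smul_neg, neg_sub]
  refine exists_isBreakingCurve_of_right (γ := fun t : ℝ => H + (t : ℂ) • K)
    (μ := fun t : ℝ => (l : ℂ) + t * Complex.I) hH (Eventually.of_forall fun t => ?_) (by simp)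
    ?_ ?_
  · exact Continuous.continuousAt (by fun_prop)
  · filter_upwards [self_mem_nhdsWithin] with t ht
    refine ⟨isPseudoHermitianWith_iff.mpr ⟨hG, hu, ?_⟩, isEigenvalue_iff.mpr ⟨ψ, ?_, hψne⟩, ?_⟩
    · rw [mul_add, mul_smul_comm]
      refine hGH.add ?_
      rw [Matrix.IsHermitian, Matrix.conjTranspose_smul, hGK.eq, Complex.star_def,
        Complex.conj_ofReal]
    · rw [Matrix.add_mulVec, Matrix.smul_mulVec, hKψ, hHψ, smul_smul, add_smul]
    · simpa using ne_of_gt (Set.mem_Ioi.mp ht)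
  · have : Continuous fun t : ℝ => (l : ℂ) + t * Complex.I := by fun_prop
    simpa using (this.tendsto 0).mono_left nhdsWithin_le_nhds

end Curves

/-! ### Symmetric intertwiners of a matrix and its transpose -/

section Transpose

open Polynomial

variable {K : Type*} [Field K]

/-- A nonzero quotient of `K[X]` is a Frobenius algebra: the coefficient of `X ^ (deg g - 1)` in the
remainder modulo `g` is a functional that vanishes on no nonzero ideal. -/
lemma exists_frobenius_functional (I : Ideal K[X]) (hI : I ≠ ⊥) :
    ∃ τ : (K[X] ⧸ I) →ₗ[K] K, ∀ u, (∀ w, τ (u * w) = 0) → u = 0 := by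
  obtain ⟨f, rfl⟩ : ∃ f, I = Ideal.span {f} :=
    ⟨_, (IsPrincipalIdealRing.principal I).span_singleton_generator.symm⟩
  have hf : f ≠ 0 := fun h => hI (by rw [h, Ideal.span_singleton_eq_bot])
  obtain ⟨g, hg, hfg⟩ : ∃ g : K[X], g.Monic ∧ Ideal.span {f} = Ideal.span {g} := by
    refine ⟨f * C f.leadingCoeff⁻¹, monic_mul_leadingCoeff_inv hf,
      (Ideal.span_singleton_mul_right_unit ?_ f).symm⟩
    exact isUnit_C.mpr (isUnit_iff_ne_zero.mpr (inv_ne_zero (leadingCoeff_ne_zero.mpr hf)))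
  rw [hfg]
  refine ⟨(lcoeff K (g.natDegree - 1)).comp (AdjoinRoot.modByMonicHom hg), fun u hu => ?_⟩
  obtain ⟨q, rfl⟩ := Ideal.Quotient.mk_surjective u
  by_contra h0
  have hr : q %ₘ g ≠ 0 := fun h => h0 (Ideal.Quotient.eq_zero_iff_mem.mpr
    (Ideal.mem_span_singleton.mpr ((modByMonic_eq_zero_iff_dvd hg).mp h)))
  have hg1 : g ≠ 1 := fun h => hr (by rw [h, modByMonic_one])
  have hdeg : (q %ₘ g).natDegree < g.natDegree := natDegree_modByMonic_lt q hg hg1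
  -- multiplication by a power of `X` moves the leading coefficient to the top position
  have hd : (q %ₘ g * X ^ (g.natDegree - 1 - (q %ₘ g).natDegree)) %ₘ g =
      q %ₘ g * X ^ (g.natDegree - 1 - (q %ₘ g).natDegree) := by
    rw [modByMonic_eq_self_iff hg]
    refine degree_lt_degree ?_
    rw [natDegree_mul_X_pow _ hr]
    omega
  have h1 := hu (Ideal.Quotient.mk _ (X ^ (g.natDegree - 1 - (q %ₘ g).natDegree)))
  rw [← map_mul] at h1
  have h2 : ((q * X ^ (g.natDegree - 1 - (q %ₘ g).natDegree)) %ₘ g).coeff (g.natDegree - 1) = 0 :=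
    h1
  have h3 : (q %ₘ g) %ₘ g = q %ₘ g :=
    (modByMonic_eq_self_iff hg).mpr (degree_modByMonic_lt q hg)
  rw [mul_modByMonic, ← h3, ← mul_modByMonic, h3, hd,
    show g.natDegree - 1 = (q %ₘ g).natDegree + (g.natDegree - 1 - (q %ₘ g).natDegree) by omega,
    coeff_mul_X_pow', if_pos (by omega)] at h2
  exact hr (leadingCoeff_eq_zero.mp (by rw [leadingCoeff, ← h2]; congr 1; omega))

/-- A symmetric nondegenerate form for which `T` is self-adjoint, glued from Frobenius functionals
`τ i` on algebras `Q i` whose sum is the given space and on which `T` acts as multiplication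
by `x i`. -/
lemma exists_selfAdjoint_form {V ι : Type*} [AddCommGroup V] [Module K V] [Fintype ι]
    {Q : ι → Type*} [∀ i, CommRing (Q i)] [∀ i, Algebra K (Q i)] (T : V →ₗ[K] V)
    (τ : ∀ i, Q i →ₗ[K] K) (hτ : ∀ i u, (∀ w, τ i (u * w) = 0) → u = 0)
    (L : ∀ i, V →ₗ[K] Q i) (x : ∀ i, Q i) (hLx : ∀ i v, L i (T v) = x i * L i v)
    (hL : ∀ i w, ∃ v, L i v = w ∧ ∀ j, j ≠ i → L j v = 0) (hL' : ∀ v, (∀ i, L i v = 0) → v = 0) :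
    ∃ B : V →ₗ[K] V →ₗ[K] K, (∀ u v, B u v = B v u) ∧ (∀ u v, B (T u) v = B u (T v)) ∧
      ∀ u, (∀ v, B u v = 0) → u = 0 := by
  let B : V →ₗ[K] V →ₗ[K] K := ∑ i, ((LinearMap.mul K (Q i)).compl₁₂ (L i) (L i)).compr₂ (τ i)
  have hB : ∀ u v, B u v = ∑ i, τ i (L i u * L i v) := fun u v => by
    simp [B, LinearMap.sum_apply]
  refine ⟨B, fun u v => ?_, fun u v => ?_, fun u hu => hL' u fun i => hτ i _ fun w => ?_⟩
  · rw [hB, hB]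
    exact Finset.sum_congr rfl fun i _ => by rw [mul_comm]
  · rw [hB, hB]
    exact Finset.sum_congr rfl fun i _ => by rw [hLx, hLx, mul_left_comm, mul_assoc]
  · obtain ⟨v, hv, hv'⟩ := hL i w
    have := hu v
    rwa [hB, Finset.sum_eq_single i (fun j _ hj => by rw [hv' j hj, mul_zero, map_zero])
      (fun h => absurd (Finset.mem_univ i) h), hv] at this

/-- Every square matrix over a field is intertwined with its transpose by a symmetric
invertible matrix: the module over `K[X]` that the matrix defines is a direct sum of quotients of
`K[X]`, on each of which a Frobenius functional `τ` gives the symmetric nondegenerate form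
`τ (u v)`, for which multiplication by `X` is self-adjoint. -/
theorem exists_symm_intertwiner {n : Type*} [Fintype n] [DecidableEq n] (H : Matrix n n K) :
    ∃ S : Matrix n n K, S.IsSymm ∧ IsUnit S ∧ S * H = H.transpose * S := by
  obtain ⟨ι, _, p, hp, e, ⟨φ⟩⟩ := Module.equiv_directSum_of_isTorsion
    (Module.AEval.isTorsion_of_finiteDimensional K (n → K) (Matrix.toLin' H))
  have hI : ∀ i, Ideal.span {p i ^ e i} ≠ ⊥ := fun i => by
    rw [Ne, Ideal.span_singleton_eq_bot]
    exact pow_ne_zero _ (hp i).ne_zero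
  choose τ hτ using fun i => exists_frobenius_functional _ (hI i)
  let L : ∀ i, (n → K) →ₗ[K] K[X] ⧸ Ideal.span {p i ^ e i} := fun i =>
    { toFun := fun v => φ (Module.AEval'.of (Matrix.toLin' H) v) i
      map_add' := fun u v => by simp only [map_add]; rfl
      map_smul' := fun c v => by
        rw [map_smul, ← Module.AEval.C_smul, map_smul, DirectSum.smul_apply]
        obtain ⟨q, hq⟩ := Ideal.Quotient.mk_surjective (φ (Module.AEval'.of (Matrix.toLin' H) v) i)
        rw [← hq, RingHom.id_apply]
        exact congrArg (Ideal.Quotient.mk _) (smul_eq_C_mul c).symm }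
  have hLX : ∀ i v, L i (Matrix.toLin' H v) = Ideal.Quotient.mk _ X * L i v := by
    intro i v
    change φ (Module.AEval'.of (Matrix.toLin' H) (Matrix.toLin' H v)) i = _
    rw [← Module.AEval'.X_smul_of, map_smul]
    rfl
  have hLsurj : ∀ i w, ∃ v, L i v = w ∧ ∀ j, j ≠ i → L j v = 0 := by
    intro i w
    classical
    refine ⟨(Module.AEval'.of (Matrix.toLin' H)).symm (φ.symm (DirectSum.of _ i w)), ?_, ?_⟩
    · change φ (Module.AEval'.of (Matrix.toLin' H) _) i = _
      rw [LinearEquiv.apply_symm_apply, LinearEquiv.apply_symm_apply, DirectSum.of_eq_same]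
    · intro j hj
      change φ (Module.AEval'.of (Matrix.toLin' H) _) j = _
      rw [LinearEquiv.apply_symm_apply, LinearEquiv.apply_symm_apply,
        DirectSum.of_eq_of_ne _ _ _ hj]
  have hLinj : ∀ v, (∀ i, L i v = 0) → v = 0 := by
    intro v hv
    have : φ (Module.AEval'.of (Matrix.toLin' H) v) = 0 := DFinsupp.ext hv
    simpa using this
  obtain ⟨B, hBsymm, hBH, hBnd⟩ :=
    exists_selfAdjoint_form (Matrix.toLin' H) τ hτ L _ hLX hLsurj hLinj
  have hS : ∀ u v, u ⬝ᵥ (LinearMap.toMatrix₂' K B).mulVec v = B u v := fun u v => by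
    rw [← Matrix.toLinearMap₂'_apply', Matrix.toLinearMap₂'_toMatrix']
  have hext : ∀ M M' : Matrix n n K, (∀ u v, u ⬝ᵥ M.mulVec v = u ⬝ᵥ M'.mulVec v) → M = M' := by
    intro M M' h
    exact Matrix.toLin'.injective (LinearMap.ext fun v => dotProduct_eq _ _ fun u => by
      rw [dotProduct_comm, dotProduct_comm _ u]; exact h u v)
  refine ⟨LinearMap.toMatrix₂' K B, hext _ _ fun u v => ?_, ?_, hext _ _ fun u v => ?_⟩
  · rw [hS, Matrix.mulVec_transpose, dotProduct_comm, ← Matrix.dotProduct_mulVec, hS, hBsymm]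
  · rw [← Matrix.mulVec_injective_iff_isUnit]
    refine (injective_iff_map_eq_zero (LinearMap.toMatrix₂' K B).mulVecLin).mpr
      fun v hv => hBnd v fun u => ?_
    rw [hBsymm, ← hS]
    have : (LinearMap.toMatrix₂' K B).mulVec v = 0 := hv
    rw [this, dotProduct_zero]
  · rw [← Matrix.mulVec_mulVec, hS, ← Matrix.mulVec_mulVec, Matrix.dotProduct_mulVec,
      Matrix.vecMul_transpose, hS, ← Matrix.toLin'_apply, ← hBH, Matrix.toLin'_apply]

end Transpose

/-! ### Metrics for a matrix similar to its adjoint -/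

section Metrics

variable {n : Type*} [Fintype n] [DecidableEq n]

/-- A pencil `A + z B` that is invertible for one complex `z` is invertible for some real one, as
its determinant is a polynomial in `z`. -/
lemma exists_real_isUnit_add_smul {A B : Matrix n n ℂ} {z : ℂ} (h : IsUnit (A + z • B)) :
    ∃ t : ℝ, IsUnit (A + (t : ℂ) • B) := by
  set p : Polynomial ℂ :=
    (A.map Polynomial.C + (Polynomial.X : Polynomial ℂ) • B.map Polynomial.C).det
    with hp
  have hev : ∀ w : ℂ, p.eval w = (A + w • B).det := fun w => by
    rw [← Polynomial.coe_evalRingHom, hp, RingHom.map_det]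
    congr 1
    ext i j
    simp [mul_comm w]
  have hp0 : p ≠ 0 := by
    intro h0
    rw [Matrix.isUnit_iff_isUnit_det, ← hev, h0, Polynomial.eval_zero] at h
    exact not_isUnit_zero h
  by_contra! hc
  refine hp0 (Polynomial.eq_zero_of_infinite_isRoot p
    ((Set.infinite_range_of_injective Complex.ofReal_injective).mono ?_))
  rintro _ ⟨t, rfl⟩
  have := hc t
  rw [Matrix.isUnit_iff_isUnit_det, ← hev, isUnit_iff_ne_zero, not_not] at this
  exact this

/-- If an invertible `M` intertwines `H` with its adjoint, then so do the Hermitian matrices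
`M + M*` and `i (M - M*)`; some real combination of them is invertible, since the
combination with the coefficient `-i` is `2 M`. -/
lemma isPseudoHermitian_of_intertwiner {H M : Matrix n n ℂ} (hM : IsUnit M)
    (h : H.conjTranspose * M = M * H) : IsPseudoHermitian H := by
  have h' : H.conjTranspose * M.conjTranspose = M.conjTranspose * H := by
    simpa using (congrArg Matrix.conjTranspose h).symm
  obtain ⟨t, ht⟩ := exists_real_isUnit_add_smul (A := M + M.conjTranspose)
    (B := Complex.I • (M - M.conjTranspose)) (z := -Complex.I) (by
      rw [smul_smul, neg_mul, Complex.I_mul_I, neg_neg, one_smul, add_add_sub_cancel, ← two_smul ℂ]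
      exact hM.smul (Units.mk0 (2 : ℂ) two_ne_zero))
  set G := M + M.conjTranspose + (t : ℂ) • Complex.I • (M - M.conjTranspose) with hGdef
  have hG : G.IsHermitian := by
    rw [Matrix.IsHermitian, hGdef]
    simp only [Matrix.conjTranspose_add, Matrix.conjTranspose_smul, Matrix.conjTranspose_sub,
      Matrix.conjTranspose_conjTranspose, Complex.star_def, Complex.conj_ofReal, Complex.conj_I,
      neg_smul, ← smul_neg, neg_sub, add_comm M.conjTranspose]
  refine ⟨G, isPseudoHermitianWith_iff.mpr ⟨hG, ht, ?_⟩⟩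
  rw [Matrix.IsHermitian, Matrix.conjTranspose_mul, hG.eq, hGdef]
  simp only [mul_add, add_mul, mul_sub, sub_mul, mul_smul_comm, smul_mul_assoc, h, h']

/-- With `S` symmetric and `S H = Hᵀ S`, the matrix `Pᵀ S` intertwines `H` with its adjoint
because `P` intertwines `H` with its conjugate. -/
theorem IsPTSymmetric.isPseudoHermitian {P H : Matrix n n ℂ} (hP : IsParity P)
    (h : IsPTSymmetric P H) : IsPseudoHermitian H := by
  obtain ⟨S, -, hSu, hSH⟩ := exists_symm_intertwiner H
  have hPu : IsUnit P.transpose := by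
    refine (Matrix.isUnit_transpose P).mpr (IsUnit.of_mul_eq_one _ hP)
  have hH : H.conjTranspose = (conjMatrix H).transpose := rfl
  refine isPseudoHermitian_of_intertwiner (hPu.mul hSu) ?_
  have h1 : (conjMatrix H).transpose * P.transpose = P.transpose * H.transpose := by
    rw [← Matrix.transpose_mul, ← Matrix.transpose_mul]
    exact congrArg Matrix.transpose h
  rw [hH, ← mul_assoc, h1, mul_assoc, ← hSH, mul_assoc]

end Metrics

/-! ### Breaking a real Krein collision -/

section RealPerturbation

variable {n : Type*} [Fintype n]

/-- For vectors `f`, `g` dual to `a`, `b`, the symmetric matrix that sends `a` to `α` and `b` to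
`β`, provided that `a · β = b · α`. -/
def symmetricExtension (a b f g α β : n → ℝ) : Matrix n n ℝ :=
  (Matrix.vecMulVec α f + Matrix.vecMulVec f α) + (Matrix.vecMulVec β g + Matrix.vecMulVec g β)
    - ((a ⬝ᵥ α) • Matrix.vecMulVec f f + (b ⬝ᵥ β) • Matrix.vecMulVec g g
      + (a ⬝ᵥ β) • (Matrix.vecMulVec f g + Matrix.vecMulVec g f))

variable {a b f g α β : n → ℝ}

lemma symmetricExtension_isSymm : (symmetricExtension a b f g α β).IsSymm := by
  rw [Matrix.IsSymm, symmetricExtension]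
  simp only [Matrix.transpose_add, Matrix.transpose_sub, Matrix.transpose_smul,
    Matrix.transpose_vecMulVec]
  rw [add_comm (Matrix.vecMulVec f α), add_comm (Matrix.vecMulVec g β),
    add_comm (Matrix.vecMulVec g f)]

lemma symmetricExtension_mulVec_left (hfa : f ⬝ᵥ a = 1) (hga : g ⬝ᵥ a = 0) :
    (symmetricExtension a b f g α β).mulVec a = α := by
  simp only [symmetricExtension, Matrix.sub_mulVec, Matrix.add_mulVec, Matrix.smul_mulVec,
    Matrix.vecMulVec_mulVec, hfa, hga, dotProduct_comm α a, dotProduct_comm β a]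
  simp

lemma symmetricExtension_mulVec_right (hfb : f ⬝ᵥ b = 0) (hgb : g ⬝ᵥ b = 1)
    (h : a ⬝ᵥ β = b ⬝ᵥ α) : (symmetricExtension a b f g α β).mulVec b = β := by
  simp only [symmetricExtension, Matrix.sub_mulVec, Matrix.add_mulVec, Matrix.smul_mulVec,
    Matrix.vecMulVec_mulVec, hfb, hgb, dotProduct_comm α b, dotProduct_comm β b, ← h]
  simp only [MulOpposite.op_zero, MulOpposite.op_one, zero_smul, one_smul, smul_zero,
    add_zero, zero_add, op_smul_eq_smul]
  abel

/-- The Gram determinant of two vectors. -/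
def gram (a b : n → ℝ) : ℝ := (a ⬝ᵥ a) * (b ⬝ᵥ b) - (a ⬝ᵥ b) ^ 2

lemma gram_ne_zero (ha : a ≠ 0) (hb : ∀ c : ℝ, b ≠ c • a) : gram a b ≠ 0 := by
  intro h
  have haa : a ⬝ᵥ a ≠ 0 := dotProduct_self_eq_zero.not.mpr ha
  have hw : (a ⬝ᵥ a) • b - (a ⬝ᵥ b) • a = 0 := by
    rw [← dotProduct_self_eq_zero]
    simp only [dotProduct_sub, sub_dotProduct, dotProduct_smul, smul_dotProduct, smul_eq_mul,
      dotProduct_comm b a]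
    unfold gram at h
    linear_combination (a ⬝ᵥ a) * h
  refine hb ((a ⬝ᵥ a)⁻¹ * (a ⬝ᵥ b)) ?_
  rw [mul_smul, ← sub_eq_zero.mp hw, smul_smul, inv_mul_cancel₀ haa, one_smul]

lemma dual_dotProduct (h : gram a b ≠ 0) :
    ((gram a b)⁻¹ • ((b ⬝ᵥ b) • a - (a ⬝ᵥ b) • b)) ⬝ᵥ a = 1 ∧
      ((gram a b)⁻¹ • ((b ⬝ᵥ b) • a - (a ⬝ᵥ b) • b)) ⬝ᵥ b = 0 ∧
      ((gram a b)⁻¹ • ((a ⬝ᵥ a) • b - (a ⬝ᵥ b) • a)) ⬝ᵥ a = 0 ∧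
      ((gram a b)⁻¹ • ((a ⬝ᵥ a) • b - (a ⬝ᵥ b) • a)) ⬝ᵥ b = 1 := by
  have h' := inv_mul_cancel₀ h
  simp only [sub_dotProduct, smul_dotProduct, smul_eq_mul, dotProduct_comm b a]
  refine ⟨?_, ?_, ?_, ?_⟩
  · rw [← h', gram]; ring
  · ring
  · ring
  · rw [← h', gram]; ring

variable [DecidableEq n] {G H : Matrix n n ℝ} {l : ℝ} {ψ : n → ℝ}

/-- Either the eigenspace of `ψ` contains a second independent vector, or it is spanned by `ψ`; in
the latter case `G ψ` is orthogonal to it, hence lies in the range of the symmetric matrix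
`G (H - l)`, so that `ψ` begins a Jordan chain. -/
lemma exists_independent_chain (hG : G.IsSymm) (hu : IsUnit G) (hGH : (G * H).IsSymm)
    (hψ : ψ ≠ 0) (hHψ : H.mulVec ψ = l • ψ) (h0 : ψ ⬝ᵥ G.mulVec ψ = 0) :
    ∃ (b : n → ℝ) (k : ℝ), 0 ≤ k ∧ (∀ c : ℝ, b ≠ c • ψ) ∧ H.mulVec b = l • b + k • ψ := by
  by_cases hc : ∃ b, H.mulVec b = l • b ∧ ∀ c : ℝ, b ≠ c • ψ
  · obtain ⟨b, hb, hb'⟩ := hc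
    exact ⟨b, 0, le_rfl, hb', by rw [hb, zero_smul, add_zero]⟩
  push Not at hc
  set N : Matrix n n ℝ := H - l • 1 with hN
  have hNv : ∀ v, N.mulVec v = H.mulVec v - l • v := fun v => by
    rw [hN, Matrix.sub_mulVec, Matrix.smul_mulVec, Matrix.one_mulVec]
  have hGN : (G * N).transpose = G * N := by
    rw [hN, mul_sub, mul_smul_comm, mul_one, Matrix.transpose_sub, Matrix.transpose_smul, hGH.eq,
      hG.eq]
  have hinj : Function.Injective G.mulVec := Matrix.mulVec_injective_of_isUnit hu
  have hmem : G.mulVec ψ ∈ LinearMap.range (Matrix.toLin' (G * N)) := by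
    by_contra hmem
    obtain ⟨F, hF, hle⟩ := Submodule.exists_le_ker_of_notMem hmem
    obtain ⟨w, rfl⟩ := (dotProductEquiv ℝ n).surjective F
    have hw : ∀ v, w ⬝ᵥ (G * N).mulVec v = 0 := fun v => hle ⟨v, rfl⟩
    have hw' : (G * N).mulVec w = 0 := by
      refine dotProduct_eq_zero _ fun v => ?_
      rw [← hGN, Matrix.mulVec_transpose, ← Matrix.dotProduct_mulVec]
      exact hw v
    have hw'' : N.mulVec w = 0 := hinj (by rw [Matrix.mulVec_mulVec, hw', Matrix.mulVec_zero])
    obtain ⟨c, rfl⟩ := hc w (sub_eq_zero.mp (by rw [← hNv]; exact hw''))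
    refine hF ?_
    change (c • ψ) ⬝ᵥ G.mulVec ψ = 0
    rw [smul_dotProduct, h0, smul_zero]
  obtain ⟨b, hb⟩ := hmem
  have hb' : N.mulVec b = ψ := hinj (by rw [Matrix.mulVec_mulVec]; exact hb)
  refine ⟨b, 1, zero_le_one, ?_, ?_⟩
  · rintro c rfl
    rw [Matrix.mulVec_smul, hNv, hHψ, sub_self, smul_zero] at hb'
    exact hψ hb'.symm
  · rw [one_smul, ← hb', hNv, add_sub_cancel]

/-- A vector `h` of zero action with prescribed inner product with `ψ`. -/
lemma exists_isotropic_partner (hG : G.IsSymm) (hu : IsUnit G) (hψ : ψ ≠ 0)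
    (h0 : ψ ⬝ᵥ G.mulVec ψ = 0) (r : ℝ) :
    ∃ h : n → ℝ, h ⬝ᵥ G.mulVec h = 0 ∧ ψ ⬝ᵥ G.mulVec h = r := by
  have hψψ : ψ ⬝ᵥ ψ ≠ 0 := dotProduct_self_eq_zero.not.mpr hψ
  have hd := (Matrix.isUnit_iff_isUnit_det G).mp hu
  set y := (ψ ⬝ᵥ ψ)⁻¹ • G⁻¹.mulVec ψ with hy
  have hGy : G.mulVec y = (ψ ⬝ᵥ ψ)⁻¹ • ψ := by
    rw [hy, Matrix.mulVec_smul, Matrix.mulVec_mulVec, Matrix.mul_nonsing_inv G hd,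
      Matrix.one_mulVec]
  have h1 : ψ ⬝ᵥ G.mulVec y = 1 := by
    rw [hGy, dotProduct_smul, smul_eq_mul, inv_mul_cancel₀ hψψ]
  have h2 : y ⬝ᵥ G.mulVec ψ = 1 := by
    rw [← h1, Matrix.dotProduct_mulVec ψ, ← Matrix.mulVec_transpose, hG.eq, dotProduct_comm]
  refine ⟨r • (y - ((y ⬝ᵥ G.mulVec y) / 2) • ψ), ?_, ?_⟩
  · simp only [Matrix.mulVec_smul, Matrix.mulVec_sub, dotProduct_smul, smul_dotProduct,
      dotProduct_sub, sub_dotProduct, h0, h1, h2, smul_eq_mul]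
    ring
  · simp only [Matrix.mulVec_smul, Matrix.mulVec_sub, dotProduct_smul, dotProduct_sub, h0, h1,
      smul_eq_mul]
    ring

/-- Let `H b = l b + k ψ` with `b` independent of `ψ`, and `h` of zero action with
`2 ψᵀ G h = - bᵀ G b`. Then `a + i t b` with `a = ψ + t² h` has zero action for all real `t`, and
this is the only obstruction to making it an eigenvector, for the eigenvalue `l + i t (k + t)`,
by a symmetric perturbation; the perturbation is small since `a + i t b` is an
eigenvector up to an error that is small in comparison with `t`. -/
theorem exists_real_perturbation (hG : G.IsSymm) (hu : IsUnit G) (hGH : (G * H).IsSymm)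
    (hψ : ψ ≠ 0) (hHψ : H.mulVec ψ = l • ψ) (h0 : ψ ⬝ᵥ G.mulVec ψ = 0) :
    ∃ (K : ℝ → Matrix n n ℝ) (σ : ℝ → ℝ), (∀ᶠ t in 𝓝 0, ContinuousAt K t) ∧ K 0 = 0 ∧
      Continuous σ ∧ σ 0 = 0 ∧ (∀ t, 0 < t → 0 < σ t) ∧ (∀ t, (G * K t).IsSymm) ∧
      ∀ᶠ t in 𝓝[>] 0, ∃ a b : n → ℝ, b ≠ 0 ∧ (H + K t).mulVec a = l • a - σ t • b ∧
        (H + K t).mulVec b = σ t • a + l • b := by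
  obtain ⟨b, k, hk, hb, hHb⟩ := exists_independent_chain hG hu hGH hψ hHψ h0
  obtain ⟨h, hh, hψh⟩ := exists_isotropic_partner hG hu hψ h0 (-(b ⬝ᵥ G.mulVec b) / 2)
  have hd := (Matrix.isUnit_iff_isUnit_det G).mp hu
  have hsymm : ∀ x y, x ⬝ᵥ G.mulVec y = y ⬝ᵥ G.mulVec x := fun x y => by
    rw [Matrix.dotProduct_mulVec x, ← Matrix.mulVec_transpose, hG.eq, dotProduct_comm]
  have hself : b ⬝ᵥ G.mulVec (H.mulVec h) = h ⬝ᵥ G.mulVec (H.mulVec b) := by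
    rw [Matrix.mulVec_mulVec, Matrix.mulVec_mulVec, Matrix.dotProduct_mulVec b,
      ← Matrix.mulVec_transpose, hGH.eq, dotProduct_comm]
  let a : ℝ → n → ℝ := fun t => ψ + t ^ 2 • h
  let α : ℝ → n → ℝ := fun t =>
    G.mulVec (-(t ^ 2 * (k + t)) • b - t ^ 2 • (H.mulVec h - l • h))
  let β : ℝ → n → ℝ := fun t => G.mulVec ((k + t) • a t - k • ψ)
  let f : ℝ → n → ℝ := fun t => (gram (a t) b)⁻¹ • ((b ⬝ᵥ b) • a t - (a t ⬝ᵥ b) • b)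
  let g : ℝ → n → ℝ := fun t => (gram (a t) b)⁻¹ • ((a t ⬝ᵥ a t) • b - (a t ⬝ᵥ b) • a t)
  let Q : ℝ → Matrix n n ℝ := fun t => symmetricExtension (a t) b (f t) (g t) (α t) (β t)
  have ha0 : a 0 = ψ := by simp [a]
  have hac : Continuous a := by fun_prop
  have hDc : Continuous fun t => gram (a t) b := by unfold gram; fun_prop
  have hD : ∀ᶠ t in 𝓝 0, gram (a t) b ≠ 0 :=
    hDc.continuousAt.eventually_ne (by rw [ha0]; exact gram_ne_zero hψ hb)
  have hαc : Continuous α := by fun_prop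
  have hβc : Continuous β := by fun_prop
  have hQc : ∀ t, gram (a t) b ≠ 0 → ContinuousAt Q t := by
    intro t ht
    have hi : ContinuousAt (fun t => (gram (a t) b)⁻¹) t := hDc.continuousAt.inv₀ ht
    have hf : ContinuousAt f t := hi.smul (by fun_prop)
    have hg : ContinuousAt g t := hi.smul (by fun_prop)
    have hac := hac.continuousAt (x := t)
    have hαc := hαc.continuousAt (x := t)
    have hβc := hβc.continuousAt (x := t)
    have hdot : ∀ {u v : ℝ → n → ℝ}, ContinuousAt u t → ContinuousAt v t →
        ContinuousAt (fun t => u t ⬝ᵥ v t) t := fun {u v} hu hv =>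
      (continuous_fst.dotProduct continuous_snd : Continuous fun p : (n → ℝ) × (n → ℝ) =>
        p.1 ⬝ᵥ p.2).continuousAt.comp (f := fun t => (u t, v t)) (hu.prodMk hv)
    have hvv : ∀ {u v : ℝ → n → ℝ}, ContinuousAt u t → ContinuousAt v t →
        ContinuousAt (fun t => Matrix.vecMulVec (u t) (v t)) t := fun {u v} hu hv =>
      continuousAt_pi.mpr fun i => continuousAt_pi.mpr fun j =>
        ((continuousAt_pi.mp hu i).mul (continuousAt_pi.mp hv j) :
          ContinuousAt (fun t => u t i * v t j) t)
    exact (((hvv hαc hf).add (hvv hf hαc)).add ((hvv hβc hg).add (hvv hg hβc))).sub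
      ((((hdot hac hαc).smul (hvv hf hf)).add ((hdot continuousAt_const hβc).smul (hvv hg hg))).add
        ((hdot hac hβc).smul ((hvv hf hg).add (hvv hg hf))))
  have hcons : ∀ t, a t ⬝ᵥ β t = b ⬝ᵥ α t := by
    intro t
    simp only [a, α, β, Matrix.mulVec_add, Matrix.mulVec_sub, Matrix.mulVec_smul, dotProduct_add,
      dotProduct_sub, dotProduct_smul, add_dotProduct, smul_dotProduct, smul_eq_mul, hself, hHb,
      hsymm h ψ, hsymm h b, hh, hψh, h0]
    ring
  have hGK : ∀ t, G * (G⁻¹ * Q t) = Q t := fun t => by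
    rw [← mul_assoc, Matrix.mul_nonsing_inv G hd, one_mul]
  have hGinv : ∀ v, G⁻¹.mulVec (G.mulVec v) = v := fun v => by
    rw [Matrix.mulVec_mulVec, Matrix.nonsing_inv_mul G hd, Matrix.one_mulVec]
  refine ⟨fun t => G⁻¹ * Q t, fun t => t * (k + t), ?_, ?_, by fun_prop, by simp, ?_, ?_, ?_⟩
  · filter_upwards [hD] with t ht
    exact (Continuous.matrix_mul continuous_const continuous_id).continuousAt.comp (hQc t ht)
  · have hα0 : α 0 = 0 := by simp [α]
    have hβ0 : β 0 = 0 := by simp [β, a]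
    have : Q 0 = 0 := by
      simp only [Q, hα0, hβ0, symmetricExtension]
      simp
    exact (congrArg (G⁻¹ * ·) this).trans (mul_zero _)
  · intro t ht
    positivity
  · intro t
    rw [hGK]
    exact symmetricExtension_isSymm
  · filter_upwards [hD.filter_mono nhdsWithin_le_nhds, self_mem_nhdsWithin] with t ht ht0
    obtain ⟨hfa, hfb, hga, hgb⟩ := dual_dotProduct ht
    have hb0 : b ≠ 0 := fun h => hb 0 (by rw [h, zero_smul])
    have hKa : (G⁻¹ * Q t).mulVec (a t) =
        -(t ^ 2 * (k + t)) • b - t ^ 2 • (H.mulVec h - l • h) := by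
      rw [← Matrix.mulVec_mulVec, symmetricExtension_mulVec_left hfa hga, hGinv]
    have hKb : (G⁻¹ * Q t).mulVec b = (k + t) • a t - k • ψ := by
      rw [← Matrix.mulVec_mulVec, symmetricExtension_mulVec_right hfb hgb (hcons t), hGinv]
    refine ⟨a t, t • b, smul_ne_zero (ne_of_gt ht0) hb0, ?_, ?_⟩
    · rw [Matrix.add_mulVec, hKa]
      simp only [a, Matrix.mulVec_add, Matrix.mulVec_smul, hHψ]
      module
    · rw [Matrix.add_mulVec, Matrix.mulVec_smul, Matrix.mulVec_smul, hKb, hHb]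
      module

end RealPerturbation

/-! ### Real coordinates for a real parity operator -/

section RealStructure

variable {n : Type*}

lemma conjMatrix_conjMatrix (M : Matrix n n ℂ) : conjMatrix (conjMatrix M) = M := by
  ext i j
  simp [conjMatrix]

lemma conjMatrix_ofReal (M : Matrix n n ℝ) :
    conjMatrix (M.map Complex.ofReal) = M.map Complex.ofReal := by
  ext i j
  simp [conjMatrix]

lemma exists_ofReal_of_conjMatrix_eq {M : Matrix n n ℂ} (h : conjMatrix M = M) :
    ∃ R : Matrix n n ℝ, M = R.map Complex.ofReal := by
  refine ⟨M.map Complex.re, ?_⟩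
  ext i j
  have := congrFun (congrFun h i) j
  exact (Complex.conj_eq_iff_re.mp this).symm

lemma isHermitian_ofReal {M : Matrix n n ℝ} :
    (M.map Complex.ofReal).IsHermitian ↔ M.IsSymm := by
  rw [Matrix.IsHermitian, Matrix.IsSymm, ← Matrix.ext_iff, ← Matrix.ext_iff]
  simp

variable [Fintype n]

lemma conjMatrix_mul (M N : Matrix n n ℂ) :
    conjMatrix (M * N) = conjMatrix M * conjMatrix N := Matrix.map_mul

lemma ofReal_mul (M N : Matrix n n ℝ) :
    (M * N).map Complex.ofReal = M.map Complex.ofReal * N.map Complex.ofReal :=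
  Matrix.map_mul (f := Complex.ofRealHom)

omit [Fintype n] in
lemma conjMatrix_conjTranspose (M : Matrix n n ℂ) :
    conjMatrix M.conjTranspose = (conjMatrix M).conjTranspose := by
  ext i j
  simp [conjMatrix]

lemma ofReal_mulVec (M : Matrix n n ℝ) (a b : n → ℝ) :
    (M.map Complex.ofReal).mulVec (fun i => (a i : ℂ) + b i * Complex.I) =
      fun i => ((M.mulVec a i : ℝ) : ℂ) + (M.mulVec b i : ℝ) * Complex.I := by
  ext i
  simp only [Matrix.mulVec, dotProduct, Matrix.map_apply, Complex.ofReal_sum, Complex.ofReal_mul,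
    Finset.sum_mul, ← Finset.sum_add_distrib]
  exact Finset.sum_congr rfl fun j _ => by ring

lemma action_ofReal (M : Matrix n n ℝ) (a b : n → ℝ) :
    action (M.map Complex.ofReal) (fun i => (a i : ℂ) + b i * Complex.I) =
      a ⬝ᵥ M.mulVec a + b ⬝ᵥ M.mulVec b := by
  rw [action, ofReal_mulVec]
  simp only [dotProduct, Complex.re_sum, ← Finset.sum_add_distrib]
  exact Finset.sum_congr rfl fun j _ => by simp

variable [DecidableEq n]

lemma isUnit_ofReal {M : Matrix n n ℝ} : IsUnit (M.map Complex.ofReal) ↔ IsUnit M := by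
  rw [Matrix.isUnit_iff_isUnit_det, Matrix.isUnit_iff_isUnit_det, isUnit_iff_ne_zero,
    isUnit_iff_ne_zero, ← Complex.ofReal_ne_zero]
  have : (M.map Complex.ofReal).det = (M.det : ℂ) := (RingHom.map_det Complex.ofRealHom M).symm
  rw [this]

/-- The matrix `((1 + P) + i (1 - P)) / 2`, whose columns are fixed by the antilinear involution
`x ↦ P x̄` when `P` is a real parity operator. -/
noncomputable def realFrame (P : Matrix n n ℂ) : Matrix n n ℂ :=
  (2⁻¹ : ℂ) • ((1 + P) + Complex.I • (1 - P))

variable {P : Matrix n n ℂ}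

omit [Fintype n] in
lemma conjMatrix_realFrame (hr : conjMatrix P = P) :
    conjMatrix (realFrame P) = (2⁻¹ : ℂ) • ((1 + P) - Complex.I • (1 - P)) := by
  ext i j
  have h1 : (starRingEnd ℂ) (P i j) = P i j := congrFun (congrFun hr i) j
  have h2 : (starRingEnd ℂ) ((1 : Matrix n n ℂ) i j) = (1 : Matrix n n ℂ) i j := by
    rw [Matrix.one_apply]; split_ifs <;> simp
  simp only [realFrame, conjMatrix, Matrix.map_apply, Matrix.smul_apply, Matrix.add_apply,
    Matrix.sub_apply, smul_eq_mul, map_mul, map_add, map_sub, h1, h2, Complex.conj_I, map_inv₀,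
    map_ofNat]
  ring

lemma mul_conjMatrix_realFrame (hP : IsParity P) (hr : conjMatrix P = P) :
    P * conjMatrix (realFrame P) = realFrame P := by
  have hP : P * P = 1 := hP
  rw [conjMatrix_realFrame hr, realFrame]
  simp only [mul_smul_comm, mul_add, mul_sub, mul_one, hP]
  module

lemma conjMatrix_realFrame_mul (hP : IsParity P) (hr : conjMatrix P = P) :
    conjMatrix (realFrame P) * P = realFrame P := by
  have hP : P * P = 1 := hP
  rw [conjMatrix_realFrame hr, realFrame]
  simp only [smul_mul_assoc, add_mul, sub_mul, one_mul, hP]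
  module

lemma realFrame_mul (hP : IsParity P) (hr : conjMatrix P = P) :
    realFrame P * P = conjMatrix (realFrame P) := by
  have hP' : P * P = 1 := hP
  rw [← conjMatrix_realFrame_mul hP hr, mul_assoc, hP', mul_one, conjMatrix_realFrame_mul hP hr]

lemma realFrame_mul_conjMatrix (hP : IsParity P) (hr : conjMatrix P = P) :
    realFrame P * conjMatrix (realFrame P) = 1 := by
  have hP : P * P = 1 := hP
  rw [conjMatrix_realFrame hr, realFrame]
  simp only [smul_mul_assoc, mul_smul_comm, add_mul, sub_mul, mul_add, mul_sub, one_mul, mul_one,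
    hP]
  have hI : Complex.I * Complex.I = -1 := Complex.I_mul_I
  match_scalars
  · linear_combination (-2⁻¹ : ℂ) * hI
  · linear_combination (2⁻¹ : ℂ) * hI

lemma conjMatrix_mul_realFrame (hP : IsParity P) (hr : conjMatrix P = P) :
    conjMatrix (realFrame P) * realFrame P = 1 :=
  mul_eq_one_comm.mp (realFrame_mul_conjMatrix hP hr)

/-- In the coordinates of the real frame, PT-symmetric matrices are the real ones. -/
lemma isPTSymmetric_iff_exists_real (hP : IsParity P) (hr : conjMatrix P = P)
    {H : Matrix n n ℂ} : IsPTSymmetric P H ↔ ∃ R : Matrix n n ℝ,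
      H = realFrame P * R.map Complex.ofReal * conjMatrix (realFrame P) := by
  have hP' : P * P = 1 := hP
  set B := realFrame P
  constructor
  · intro h
    have h' : P * conjMatrix H = H * P := h
    have hc : conjMatrix H = P * H * P := by
      rw [mul_assoc, ← h', ← mul_assoc, hP', one_mul]
    obtain ⟨R, hR⟩ := exists_ofReal_of_conjMatrix_eq (M := conjMatrix B * H * B) (by
      rw [conjMatrix_mul, conjMatrix_mul, conjMatrix_conjMatrix, hc, mul_assoc P, ← mul_assoc B,
        realFrame_mul hP hr, mul_assoc, mul_assoc, mul_assoc, mul_conjMatrix_realFrame hP hr])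
    refine ⟨R, ?_⟩
    rw [← hR, mul_assoc, mul_assoc, mul_assoc, realFrame_mul_conjMatrix hP hr, mul_one,
      ← mul_assoc, realFrame_mul_conjMatrix hP hr, one_mul]
  · rintro ⟨R, rfl⟩
    rw [IsPTSymmetric, conjMatrix_mul, conjMatrix_mul, conjMatrix_conjMatrix, conjMatrix_ofReal,
      ← mul_assoc, ← mul_assoc, mul_conjMatrix_realFrame hP hr, mul_assoc _ _ P,
      conjMatrix_realFrame_mul hP hr]

/-- In the coordinates of the real frame, compatible metrics are the real ones. -/
lemma isCompatible_iff_exists_real (hP : IsParity P) (hr : conjMatrix P = P)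
    {G : Matrix n n ℂ} : IsCompatible P G ↔ ∃ R : Matrix n n ℝ,
      G = (conjMatrix (realFrame P)).conjTranspose * R.map Complex.ofReal *
        conjMatrix (realFrame P) := by
  set B := realFrame P
  have hBB : (conjMatrix B).conjTranspose * B.conjTranspose = 1 := by
    rw [← Matrix.conjTranspose_mul, realFrame_mul_conjMatrix hP hr, Matrix.conjTranspose_one]
  constructor
  · intro h
    obtain ⟨R, hR⟩ := exists_ofReal_of_conjMatrix_eq (M := B.conjTranspose * G * B) (by
      have h' : conjMatrix G = P.conjTranspose * G * P := h.symm
      rw [conjMatrix_mul, conjMatrix_mul, conjMatrix_conjTranspose, h']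
      have e : P * conjMatrix B = B := mul_conjMatrix_realFrame hP hr
      conv_rhs => rw [← e, Matrix.conjTranspose_mul]
      simp only [mul_assoc])
    refine ⟨R, ?_⟩
    rw [← hR, mul_assoc, mul_assoc, mul_assoc, realFrame_mul_conjMatrix hP hr, mul_one,
      ← mul_assoc, hBB, one_mul]
  · rintro ⟨R, rfl⟩
    rw [IsCompatible, conjMatrix_mul, conjMatrix_mul, conjMatrix_conjMatrix, conjMatrix_ofReal,
      conjMatrix_conjTranspose, conjMatrix_conjMatrix, mul_assoc, mul_assoc,
      conjMatrix_realFrame_mul hP hr, ← mul_assoc, ← mul_assoc, ← Matrix.conjTranspose_mul,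
      conjMatrix_realFrame_mul hP hr]

lemma isPseudoHermitianWith_realFrame_iff (hP : IsParity P) (hr : conjMatrix P = P)
    (G H : Matrix n n ℝ) :
    IsPseudoHermitianWith
      ((conjMatrix (realFrame P)).conjTranspose * G.map Complex.ofReal * conjMatrix (realFrame P))
      (realFrame P * H.map Complex.ofReal * conjMatrix (realFrame P)) ↔
    G.IsSymm ∧ IsUnit G ∧ (G * H).IsSymm := by
  set B := realFrame P
  have hB : IsUnit (conjMatrix B) := IsUnit.of_mul_eq_one _ (conjMatrix_mul_realFrame hP hr)
  have hherm : ∀ M : Matrix n n ℂ,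
      ((conjMatrix B).conjTranspose * M * conjMatrix B).IsHermitian ↔ M.IsHermitian := by
    refine fun M => ⟨fun h => ?_, Matrix.isHermitian_conjTranspose_mul_mul _⟩
    have e : B.conjTranspose * ((conjMatrix B).conjTranspose * M * conjMatrix B) * B = M := by
      rw [mul_assoc, mul_assoc _ _ B, conjMatrix_mul_realFrame hP hr, mul_one, ← mul_assoc,
        ← Matrix.conjTranspose_mul, conjMatrix_mul_realFrame hP hr, Matrix.conjTranspose_one,
        one_mul]
    exact e ▸ Matrix.isHermitian_conjTranspose_mul_mul B h
  have hu : IsUnit ((conjMatrix B).conjTranspose * G.map Complex.ofReal * conjMatrix B) ↔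
      IsUnit (G.map Complex.ofReal) := by
    rw [hB.mul_right_iff, ((Matrix.isUnit_conjTranspose _).mpr hB).mul_left_iff]
  have hGH : (conjMatrix B).conjTranspose * G.map Complex.ofReal * conjMatrix B *
      (B * H.map Complex.ofReal * conjMatrix B) =
      (conjMatrix B).conjTranspose * (G * H).map Complex.ofReal * conjMatrix B := by
    rw [ofReal_mul, mul_assoc, ← mul_assoc (conjMatrix B), ← mul_assoc (conjMatrix B) B,
      conjMatrix_mul_realFrame hP hr, one_mul]
    simp only [mul_assoc]
  rw [isPseudoHermitianWith_iff, hGH, hherm, hherm, hu, isHermitian_ofReal, isHermitian_ofReal,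
    isUnit_ofReal]

theorem IsPTSymmetric.exists_isCompatible {H : Matrix n n ℂ} (hP : IsParity P)
    (hr : conjMatrix P = P) (h : IsPTSymmetric P H) :
    ∃ G : Matrix n n ℂ, IsPseudoHermitianWith G H ∧ IsCompatible P G := by
  obtain ⟨R, rfl⟩ := (isPTSymmetric_iff_exists_real hP hr).mp h
  obtain ⟨S, hS, hSu, hSR⟩ := exists_symm_intertwiner R
  refine ⟨_, (isPseudoHermitianWith_realFrame_iff hP hr S R).mpr ⟨hS, hSu, ?_⟩,
    (isCompatible_iff_exists_real hP hr).mpr ⟨S, rfl⟩⟩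
  rw [Matrix.IsSymm, Matrix.transpose_mul, hS.eq, hSR]

omit [DecidableEq n] in
/-- A complex eigenvector `x + i y` of zero action of a real matrix gives real eigenvectors `x`,
`y` whose actions are opposite, and hence a real eigenvector of zero action. -/
lemma exists_real_isotropic {G H : Matrix n n ℝ} (hG : G.IsSymm) {l : ℝ} {ψ : n → ℂ} (hψ : ψ ≠ 0)
    (hHψ : (H.map Complex.ofReal).mulVec ψ = (l : ℂ) • ψ)
    (h0 : action (G.map Complex.ofReal) ψ = 0) :
    ∃ v : n → ℝ, v ≠ 0 ∧ H.mulVec v = l • v ∧ v ⬝ᵥ G.mulVec v = 0 := by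
  set x : n → ℝ := fun i => (ψ i).re
  set y : n → ℝ := fun i => (ψ i).im
  have hxy : ψ = fun i => (x i : ℂ) + y i * Complex.I := funext fun i => (Complex.re_add_im _).symm
  rw [hxy, action_ofReal] at h0
  rw [hxy, ofReal_mulVec] at hHψ
  have hx : H.mulVec x = l • x := funext fun i => by
    simpa using congrArg Complex.re (congrFun hHψ i)
  have hy : H.mulVec y = l • y := funext fun i => by
    simpa using congrArg Complex.im (congrFun hHψ i)
  have hsymm : y ⬝ᵥ G.mulVec x = x ⬝ᵥ G.mulVec y := by
    rw [Matrix.dotProduct_mulVec y, ← Matrix.mulVec_transpose, hG.eq, dotProduct_comm]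
  -- the quadratic argument for eigenvectors of positive and negative action
  have key : ∀ u v : n → ℝ, H.mulVec u = l • u → H.mulVec v = l • v → v ⬝ᵥ G.mulVec u =
      u ⬝ᵥ G.mulVec v → 0 < u ⬝ᵥ G.mulVec u → v ⬝ᵥ G.mulVec v < 0 →
      ∃ v : n → ℝ, v ≠ 0 ∧ H.mulVec v = l • v ∧ v ⬝ᵥ G.mulVec v = 0 := by
    intro u v hu hv huv hpos hneg
    obtain ⟨s, hs⟩ := exists_real_quadratic_zero (q := 2 * (u ⬝ᵥ G.mulVec v)) hpos hneg
    refine ⟨u + s • v, fun h => ?_, ?_, ?_⟩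
    · rw [eq_neg_of_add_eq_zero_left h, ← neg_smul, Matrix.mulVec_smul, dotProduct_smul,
        smul_dotProduct, smul_eq_mul, smul_eq_mul] at hpos
      nlinarith [mul_self_nonneg s]
    · rw [Matrix.mulVec_add, Matrix.mulVec_smul, hu, hv, smul_add, smul_comm]
    · simp only [Matrix.mulVec_add, Matrix.mulVec_smul, dotProduct_add, add_dotProduct,
        dotProduct_smul, smul_dotProduct, smul_eq_mul, huv]
      linarith
  rcases lt_trichotomy (x ⬝ᵥ G.mulVec x) 0 with h | h | h
  · exact key y x hy hx hsymm.symm (by linarith) h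
  · by_cases hx0 : x = 0
    · refine ⟨y, fun hy0 => hψ ?_, hy, by linarith⟩
      rw [hxy, hx0, hy0]
      ext i
      simp
    · exact ⟨x, hx0, hx, h⟩
  · exact key x y hx hy hsymm h (by linarith)

/-- In the coordinates of the real frame, a breaking curve is given by a symmetric perturbation of
a real eigenvector of zero action. -/
theorem IsMixedKind.exists_isBreakingCurve_ptSpace {G H : Matrix n n ℂ} {l : ℝ} (hP : IsParity P)
    (hr : conjMatrix P = P) (hPT : IsPTSymmetric P H) (hGH : IsPseudoHermitianWith G H)
    (hG : IsCompatible P G) (hl : IsMixedKind G H l) :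
    ∃ γ, IsBreakingCurve (ptSpace P G) H l γ := by
  have hmem : H ∈ ptSpace P G := ⟨hPT, hGH⟩
  obtain ⟨H', rfl⟩ := (isPTSymmetric_iff_exists_real hP hr).mp hPT
  obtain ⟨G', rfl⟩ := (isCompatible_iff_exists_real hP hr).mp hG
  obtain ⟨hGs, hGu, hGHs⟩ := (isPseudoHermitianWith_realFrame_iff hP hr _ _).mp hGH
  obtain ⟨ψ, hψ, hψ0⟩ := hl
  obtain ⟨hHψ, hψne⟩ := isEigenmode_iff.mp hψ
  set B := realFrame P with hB
  have hBB : conjMatrix B * B = 1 := conjMatrix_mul_realFrame hP hr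
  have hBB' : B * conjMatrix B = 1 := realFrame_mul_conjMatrix hP hr
  obtain ⟨v, hv, hHv, hGv⟩ := exists_real_isotropic (ψ := (conjMatrix B).mulVec ψ) (H := H')
    (l := l) hGs
    (fun h => hψne (by
      rw [← Matrix.one_mulVec ψ, ← hBB', ← Matrix.mulVec_mulVec, h, Matrix.mulVec_zero]))
    (by
      rw [← Matrix.mulVec_smul, ← hHψ, ← Matrix.mulVec_mulVec, ← Matrix.mulVec_mulVec,
        Matrix.mulVec_mulVec _ (conjMatrix B), hBB, Matrix.one_mulVec])
    (by
      rw [← hψ0, action, action, Matrix.star_mulVec, ← Matrix.dotProduct_mulVec,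
        Matrix.mulVec_mulVec, Matrix.mulVec_mulVec])
  obtain ⟨K, σ, hKc, hK0, hσc, hσ0, hσpos, hKs, hK⟩ :=
    exists_real_perturbation hGs hGu hGHs hv hHv hGv
  have hcont : Continuous fun M : Matrix n n ℝ => B * M.map Complex.ofReal * conjMatrix B := by
    have : Continuous fun M : Matrix n n ℝ => M.map Complex.ofReal :=
      continuous_id.matrix_map Complex.continuous_ofReal
    fun_prop
  refine exists_isBreakingCurve_of_right
    (γ := fun t => B * (H' + K t).map Complex.ofReal * conjMatrix B)
    (μ := fun t => (l : ℂ) + σ t * Complex.I) hmem ?_ (by simp only [hK0, add_zero]) ?_ ?_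
  · filter_upwards [hKc] with t ht
    exact hcont.continuousAt.comp (f := fun t => H' + K t) (continuousAt_const.add ht)
  · filter_upwards [hK, self_mem_nhdsWithin] with t ⟨a, b, hb, hab, hab'⟩ ht
    refine ⟨⟨(isPTSymmetric_iff_exists_real hP hr).mpr ⟨_, rfl⟩,
      (isPseudoHermitianWith_realFrame_iff hP hr _ _).mpr ⟨hGs, hGu, ?_⟩⟩,
      isEigenvalue_iff.mpr ⟨B.mulVec fun i => (a i : ℂ) + b i * Complex.I, ?_, ?_⟩, ?_⟩
    · rw [mul_add]
      exact hGHs.add (hKs t)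
    · rw [← Matrix.mulVec_mulVec, ← Matrix.mulVec_mulVec, Matrix.mulVec_mulVec _ (conjMatrix B),
        hBB, Matrix.one_mulVec, ofReal_mulVec, hab, hab', ← Matrix.mulVec_smul]
      congr 1
      ext i
      simp only [Pi.sub_apply, Pi.add_apply, Pi.smul_apply, smul_eq_mul, Complex.ofReal_sub,
        Complex.ofReal_add, Complex.ofReal_mul]
      linear_combination (-(σ t : ℂ) * b i) * Complex.I_mul_I
    · intro h
      have h' := congrArg (conjMatrix B).mulVec h
      rw [Matrix.mulVec_mulVec, hBB, Matrix.one_mulVec, Matrix.mulVec_zero] at h'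
      exact hb (funext fun i => by simpa using congrArg Complex.im (congrFun h' i))
    · simpa using (hσpos t ht).ne'
  · have : Continuous fun t : ℝ => (l : ℂ) + σ t * Complex.I := by fun_prop
    simpa [hσ0] using (this.tendsto 0).mono_left nhdsWithin_le_nhds

end RealStructure

end PTKrein

open PTKrein in
theorem mainTheorem3 {n : Type*} [Fintype n] [DecidableEq n]
    (P : Matrix n n ℂ) (hP : IsParity P) :
    -- every PT-symmetric Hamiltonian is pseudo-Hermitian, so its modes have actions
    (∀ H : Matrix n n ℂ, IsPTSymmetric P H → IsPseudoHermitian H) ∧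
    -- mixed kind means that a positive- and a negative-action mode meet, at a multiple eigenvalue
    (∀ G H : Matrix n n ℂ, IsPseudoHermitianWith G H → ∀ l : ℝ,
      (IsMixedKind G H l ↔
        ∃ v ∈ Module.End.maxGenEigenspace (Matrix.toLin' H) (l : ℂ),
        ∃ w ∈ Module.End.maxGenEigenspace (Matrix.toLin' H) (l : ℂ),
          0 < action G v ∧ action G w < 0) ∧
      (IsMixedKind G H l → 2 ≤ H.charpoly.rootMultiplicity (l : ℂ))) ∧
    -- breaking in a PT-symmetric family happens only at a Krein collision
    (∀ (X : Type*) [TopologicalSpace X] (H G : X → Matrix n n ℂ) (x₀ : X),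
      ContinuousAt H x₀ → ContinuousAt G x₀ →
      (∀ x, IsPTSymmetric P (H x)) → (∀ x, IsPseudoHermitianWith (G x) (H x)) →
      (BreaksAt H x₀ → ∃ l : ℝ, IsMixedKind (G x₀) (H x₀) l ∧ BreaksAtPoint H x₀ l) ∧
      (∀ l : ℝ, BreaksAtPoint H x₀ l → IsMixedKind (G x₀) (H x₀) l) ∧
      -- collisions of modes with the same sign of action do not break the symmetry
      (∀ l : ℝ, IsDefinite (G x₀) (H x₀) l →
        ∃ ε : ℝ, 0 < ε ∧ ∀ᶠ x in 𝓝 x₀, ∀ μ : ℂ, IsEigenvalue (H x) μ → ‖μ - l‖ < ε → μ.im = 0) ∧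
      (IsUnbroken (H x₀) → (∀ l : ℝ, IsEigenvalue (H x₀) l → IsDefinite (G x₀) (H x₀) l) →
        ∀ᶠ x in 𝓝 x₀, IsUnbroken (H x))) ∧
    -- the equivalence in the space of all pseudo-Hermitian matrices with a given metric
    (∀ G H : Matrix n n ℂ, IsPseudoHermitianWith G H →
      (IsStronglyStable (pseudoHermitianSpace G) H ↔
        IsUnbroken H ∧ ∀ l : ℝ, IsEigenvalue H l → IsDefinite G H l) ∧
      (∀ l : ℝ, IsMixedKind G H l ↔
        ∃ γ : ℝ → Matrix n n ℂ, IsBreakingCurve (pseudoHermitianSpace G) H l γ)) ∧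
    -- the equivalence in the space of the matrices that are moreover PT-symmetric
    (conjMatrix P = P →
      (∀ H : Matrix n n ℂ, IsPTSymmetric P H →
        ∃ G : Matrix n n ℂ, IsPseudoHermitianWith G H ∧ IsCompatible P G) ∧
      (∀ G H : Matrix n n ℂ, IsPTSymmetric P H → IsPseudoHermitianWith G H → IsCompatible P G →
        (IsStronglyStable (ptSpace P G) H ↔
          IsUnbroken H ∧ ∀ l : ℝ, IsEigenvalue H l → IsDefinite G H l) ∧
        (∀ l : ℝ, IsMixedKind G H l ↔
          ∃ γ : ℝ → Matrix n n ℂ, IsBreakingCurve (ptSpace P G) H l γ))) := by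
  refine ⟨fun H hH => hH.isPseudoHermitian hP, fun G H hGH l =>
    ⟨⟨exists_pos_neg_of_isMixedKind hGH, isMixedKind_of_exists_pos_neg hGH⟩,
      two_le_rootMultiplicity hGH⟩, ?_, fun G H hGH => ?_, fun hr => ⟨fun H hH =>
        hH.exists_isCompatible hP hr, fun G H hPT hGH hG => ?_⟩⟩
  · intro X _ H G x₀ hH hG _ hGH
    have hGH' : ∀ᶠ x in 𝓝 x₀, IsPseudoHermitianWith (G x) (H x) := Eventually.of_forall hGH
    have hmixed : ∀ l : ℝ, BreaksAtPoint H x₀ l → IsMixedKind (G x₀) (H x₀) l :=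
      fun l hl => NonrealAccumulate.isMixedKind hG hH hGH' hl
    have hdef := fun l : ℝ => isDefinite_iff (H := H x₀) (l := l) (hGH x₀).1
    refine ⟨fun h => ?_, hmixed, fun l hl => ?_, fun h hl => ?_⟩
    · obtain ⟨l, hl⟩ := exists_nonrealAccumulate hH h.1 h.2
      exact ⟨l, hmixed l hl, hl⟩
    · exact eventually_real_of_not_isMixedKind hG hH hGH' ((hdef l).mp hl).2
    · exact eventually_isUnbroken hG hH hGH' h fun l hm => ((hdef l).mp (hl l hm.isEigenvalue)).2 hm
  · exact ⟨isStronglyStable_iff subset_rfl hGH fun l hl => hl.exists_isBreakingCurve hGH,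
      fun l => ⟨fun hl => hl.exists_isBreakingCurve hGH,
        fun ⟨γ, hγ⟩ => hγ.isMixedKind subset_rfl⟩⟩
  · have hsub : ptSpace P G ⊆ pseudoHermitianSpace G := fun M hM => hM.2
    have hcurve := fun (l : ℝ) (hl : IsMixedKind G H l) =>
      hl.exists_isBreakingCurve_ptSpace hP hr hPT hGH hG
    exact ⟨isStronglyStable_iff hsub ⟨hPT, hGH⟩ hcurve,
      fun l => ⟨hcurve l, fun ⟨γ, hγ⟩ => hγ.isMixedKind hsub⟩⟩
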